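/- A geometric graph is a finite simple graph drawn in the plane with its vertices at distinct points, no three of them collinear, and its edges as straight-line segments, such that two distinct edges meet at most in a common endpoint (noncrossing). A compatible matching of a geometric graph $G$ is a (possibly empty) set $M$ of pairwise vertex-disjoint straight-line edges between vertices of $G$, none of them an edge of $G$, such that $G+M$ is again noncrossing. It is maximal if it is not properly contained in another compatible matching of $G$. Let $\mathrm{mm}(G)$ denote the minimum number of edges of a maximal compatible matching of $G$. **Theorem.** Let $G$ be an $n$-vertex geometric graph. (a) If $G$ is $0$-regular (a point set), then $\mathrm{mm}(G)\ge \frac{n-1}{3}$. (b) If $G$ is $1$-regular (a perfect matching), then $\mathrm{mm}(G)\ge \frac{n-2}{6}$. (c) If $G$ is $2$-regular (disjoint polygons), then $\mathrm{mm}(G)\ge \frac{n-3}{11}$. Each of these bounds is tight for infinitely many $n$: there are infinitely many $n$ for which some $n$-vertex $0$-regular geometric graph $G$ has $\mathrm{mm}(G)=\frac{n-1}{3}$, infinitely many $n$ for which some $n$-vertex $1$-regular one has $\mathrm{mm}(G)=\frac{n-2}{6}$, and infinitely many $n$ for which some $n$-vertex $2$-regular one has $\mathrm{mm}(G)=\frac{n-3}{11}$.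 -/

import Mathlib

/-- Straight-line drawing of `H` with vertex `v` placed at `p v` is noncrossing: two distinct edges
meet at most in the images of their common endpoints. -/
def IsNoncrossing {V : Type*} (p : V → ℝ × ℝ) (H : SimpleGraph V) : Prop :=
  ∀ u v x y : V, H.Adj u v → H.Adj x y → s(u, v) ≠ s(x, y) →
    segment ℝ (p u) (p v) ∩ segment ℝ (p x) (p y) ⊆ p '' (({u, v} : Set V) ∩ {x, y})

/-- A noncrossing geometric (straight-line) graph in the plane with vertices in general position.
The plane is written `ℝ × ℝ`: only its affine structure is used. -/
structure GeometricGraph (V : Type*) where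
  pos : V → ℝ × ℝ
  graph : SimpleGraph V
  pos_injective : Function.Injective pos
  general_position : ∀ u v w : V, u ≠ v → v ≠ w → u ≠ w →
    ¬ Collinear ℝ ({pos u, pos v, pos w} : Set (ℝ × ℝ))
  noncrossing : IsNoncrossing pos graph

namespace GeometricGraph

/-- `M` is a compatible matching of `G`: a matching on the vertices of `G` (every vertex has at
most one partner), using no edge of `G`, such that the drawing of `G + M` is noncrossing. -/
structure IsCompatibleMatching {V : Type*} (G : GeometricGraph V) (M : SimpleGraph V) : Prop where
  matching : ∀ v a b : V, M.Adj v a → M.Adj v b → a = b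
  disjoint : Disjoint G.graph M
  noncrossing : IsNoncrossing G.pos (G.graph ⊔ M)

/-- A compatible matching not properly contained in another compatible matching. -/
def IsMaximalCompatibleMatching {V : Type*} (G : GeometricGraph V) (M : SimpleGraph V) : Prop :=
  Maximal G.IsCompatibleMatching M

/-- The least number of edges of a maximal compatible matching of `G`. -/
noncomputable def mm {V : Type*} (G : GeometricGraph V) : ℕ :=
  sInf {k : ℕ | ∃ M : SimpleGraph V, G.IsMaximalCompatibleMatching M ∧ M.edgeSet.ncard = k}

open Classical in
/-- `G` is `d`-regular as an abstract graph. -/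
def IsRegular {V : Type*} [Fintype V] (G : GeometricGraph V) (d : ℕ) : Prop :=
  G.graph.IsRegularOfDegree d

/-- On finitely many vertices `mm` is attained, so the infimum in its definition is a minimum. -/
theorem exists_mm_eq {V : Type*} [Finite V] (G : GeometricGraph V) :
    ∃ M : SimpleGraph V, G.IsMaximalCompatibleMatching M ∧ M.edgeSet.ncard = G.mm := by
  have h0 : G.IsCompatibleMatching ⊥ :=
    ⟨fun _ _ _ h => h.elim, disjoint_bot_right, by simpa using G.noncrossing⟩
  obtain ⟨M, hM⟩ := (Set.toFinite {M | G.IsCompatibleMatching M}).exists_maximal ⟨⊥, h0⟩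
  exact Nat.sInf_mem
    (s := {k : ℕ | ∃ M, G.IsMaximalCompatibleMatching M ∧ M.edgeSet.ncard = k}) ⟨_, M, hM, rfl⟩

end GeometricGraph

/-! Lower bounds. Let `M` be a maximal compatible matching with `m` edges, so that `G + M` has `nd/2
+ m` edges. Prolong every edge along its line until each end runs into another piece or goes to
infinity. The resulting `k` pieces cut the plane into at most `k + 1` cells, and the cells are
convex because no piece has a free end: this is the transitivity of visibility (`Visible.trans`)
together with the count `finite_and_card_quotient_le`. A vertex of degree 0, 1, 2 in `G` lies in the
closure of at least 1, 2, 3 cells, since its edges end on other pieces or are prolonged through it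
(`two_cells`, `three_cells`).

Two unmatched vertices in the closure of one convex cell see each other in `G + M`, so by maximality
they are adjacent in `G`. The unmatched vertices at a cell therefore form a clique, of size at most
`d + 1`. Double counting the incidences (`exists_incidence`) gives `(d + 1)(n - 2m) ≤ (d + 1)(nd/2 +
m + 1)`, which is the bound for `d = 0` and `d = 1`. For `d = 2` this is too weak. There, a cell
with three unmatched vertices carries a triangle that is a whole component of `G`, and a triangle
belongs to at most one cell, since that cell contains its centroid. Hence at most `(n - 2m)/3` cells
carry three unmatched vertices and all others carry at most two.

Tightness. In a blocked drawing any two unmatched non-adjacent vertices are separated by an edge, so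
the matching is maximal. A skeleton is a drawing with a perfect matching of `m₀` edges and with `l`
extra points (slots) that the edges block from each other. Putting a tiny copy of a blocked drawing
into each slot gives a blocked drawing again and turns `(n, m)` into `(2m₀ + ln, m₀ + lm)`. The
relation `n = cm + d + 1` survives exactly when `2m₀ + l(d + 1) = cm₀ + d + 1`. A segment with 2
slots, a square with 5 and a twisted prism with 10 satisfy this for `c = 3, 6, 11`, and the
recursion starts from `K_{d+1}` drawn at a single point. All the separation and crossing conditions
are open, so such degenerate drawings are harmless: one small perturbation at the end gives general
position. -/

open Set Filter Topology

/-! ### Segment systems and their prolongation to full ones -/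

/-- A family of relatively open pieces of non-vertical lines, pairwise disjoint in the plane. Piece
`i` is the graph of `x ↦ slope i * x + icpt i` over the open interval `dom i`. -/
structure SegmentSystem (ι : Type*) where
  slope : ι → ℝ
  icpt : ι → ℝ
  dom : ι → Set ℝ
  isOpen_dom : ∀ i, IsOpen (dom i)
  ordConnected_dom : ∀ i, (dom i).OrdConnected
  nonempty_dom : ∀ i, (dom i).Nonempty
  disj : ∀ i j x, i ≠ j → x ∈ dom i → x ∈ dom j →
    slope i * x + icpt i ≠ slope j * x + icpt j

namespace SegmentSystem

variable {ι : Type*} (S : SegmentSystem ι)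

/-- Signed vertical distance from the `i`-th line. -/
def height (i : ι) (z : ℝ × ℝ) : ℝ := z.2 - (S.slope i * z.1 + S.icpt i)

/-- The union of all pieces. -/
def carrier : Set (ℝ × ℝ) := {z | ∃ i, z.1 ∈ S.dom i ∧ S.height i z = 0}

/-- Every endpoint of a piece lies on another piece. -/
def IsFull : Prop := ∀ i z, z.1 ∈ closure (S.dom i) → S.height i z = 0 → z ∈ S.carrier

lemma continuous_height (i : ι) : Continuous (S.height i) := by
  unfold height; fun_prop

/-- Any segment system on pairwise distinct lines extends to a full one on the same lines. -/
theorem exists_isFull [Finite ι]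
    (hl : ∀ i j, i ≠ j → S.slope i = S.slope j → S.icpt i ≠ S.icpt j) :
    ∃ T : SegmentSystem ι, T.slope = S.slope ∧ T.icpt = S.icpt ∧ (∀ i, S.dom i ⊆ T.dom i) ∧
      T.IsFull := by
  classical
  -- Zorn's lemma on families of open intervals on the fixed lines, ordered by inclusion. In a
  -- maximal family, an end lying on no piece could still be pushed further.
  let A : Set (ι → Set ℝ) := {J | (∀ i, IsOpen (J i)) ∧ (∀ i, (J i).OrdConnected) ∧
    ∀ i j x, i ≠ j → x ∈ J i → x ∈ J j → S.slope i * x + S.icpt i ≠ S.slope j * x + S.icpt j}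
  obtain ⟨J, hSJ, hJ⟩ := zorn_le_nonempty₀ A (by
    intro c hc hchain y hy
    refine ⟨fun i => ⋃ K ∈ c, K i, ⟨?_, ?_, ?_⟩, ?_⟩
    · exact fun i => isOpen_biUnion fun K hK => (hc hK).1 i
    · intro i
      constructor
      intro x hx x' hx'
      simp only [mem_iUnion, exists_prop] at hx hx'
      obtain ⟨K, hK, hx⟩ := hx
      obtain ⟨K', hK', hx'⟩ := hx'
      rcases hchain.total hK hK' with h | h
      · exact ((((hc hK').2.1 i).out (h i hx) hx').trans
          (subset_biUnion_of_mem (u := fun K : ι → Set ℝ => K i) hK'))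
      · exact ((((hc hK).2.1 i).out hx (h i hx')).trans
          (subset_biUnion_of_mem (u := fun K : ι → Set ℝ => K i) hK))
    · intro i j x hij hx hx'
      simp only [mem_iUnion, exists_prop] at hx hx'
      obtain ⟨K, hK, hx⟩ := hx
      obtain ⟨K', hK', hx'⟩ := hx'
      rcases hchain.total hK hK' with h | h
      · exact (hc hK').2.2 i j x hij (h i hx) hx'
      · exact (hc hK).2.2 i j x hij hx (h j hx')
    · intro K hK i
      exact subset_biUnion_of_mem (u := fun K : ι → Set ℝ => K i) hK)
    S.dom ⟨S.isOpen_dom, S.ordConnected_dom, S.disj⟩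
  obtain ⟨⟨hJo, hJc, hJd⟩, hmax⟩ := hJ
  refine ⟨⟨S.slope, S.icpt, J, hJo, hJc, fun i => (S.nonempty_dom i).mono (hSJ i), hJd⟩, rfl, rfl,
    hSJ, ?_⟩
  rintro i ⟨x, y⟩ hx hy
  by_contra hX
  simp only [carrier, height, mem_ofPred_eq, not_exists, not_and] at hX hx hy
  have hxi : x ∉ J i := fun h => hX i h hy
  -- Near the free end no other piece meets line `i`. A line through that end differs from line `i`,
  -- hence meets it only there, where its own piece is absent; any other line misses a neighbourhood
  -- of the end.
  have hev : ∀ᶠ x' in 𝓝 x, ∀ j, j ≠ i → x' ∈ J j →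
      S.slope i * x' + S.icpt i ≠ S.slope j * x' + S.icpt j := by
    rw [eventually_all]
    intro j
    by_cases hji : j = i
    · simp [hji]
    by_cases hg : S.slope i * x + S.icpt i = S.slope j * x + S.icpt j
    · have hxj : x ∉ J j := fun h => hX j h (by linarith)
      refine Eventually.of_forall fun x' _ hx' he => ?_
      have hne : x' ≠ x := fun h => hxj (h ▸ hx')
      have hs : (S.slope i - S.slope j) * (x' - x) = 0 := by linarith
      rcases mul_eq_zero.1 hs with h | h
      · exact hl i j (Ne.symm hji) (by linarith) (by
          have : S.slope i = S.slope j := by linarith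
          rw [this] at hg; linarith)
      · exact hne (by linarith)
    · have hcont : ContinuousAt (fun x => S.slope i * x + S.icpt i - (S.slope j * x + S.icpt j)) x :=
        by fun_prop
      filter_upwards [hcont.eventually_ne (sub_ne_zero.2 hg)] with x' hx' _ _ he
      exact hx' (sub_eq_zero.2 he)
  obtain ⟨ε, hε, hball⟩ := Metric.eventually_nhds_iff_ball.1 hev
  have hmem : Function.update J i (J i ∪ Metric.ball x ε) ∈ A := by
    refine ⟨?_, ?_, ?_⟩
    · intro k
      by_cases hk : k = i
      · subst hk; simpa using (hJo k).union Metric.isOpen_ball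
      · simpa [hk] using hJo k
    · intro k
      by_cases hk : k = i
      · subst hk
        obtain ⟨x', hx', hx''⟩ := mem_closure_iff.1 hx _ Metric.isOpen_ball (Metric.mem_ball_self hε)
        simp only [Function.update_self]
        exact isPreconnected_iff_ordConnected.1 (IsPreconnected.union x' hx'' hx'
          (isPreconnected_iff_ordConnected.2 (hJc k)) (convex_ball x ε).isPreconnected)
      · simpa [hk] using hJc k
    · have key : ∀ j x', j ≠ i → x' ∈ J i ∪ Metric.ball x ε → x' ∈ J j →
          S.slope i * x' + S.icpt i ≠ S.slope j * x' + S.icpt j := by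
        rintro j x' hj (h | h) h'
        · exact hJd i j x' (Ne.symm hj) h h'
        · exact hball x' h j hj h'
      intro k l x' hkl hk hl'
      by_cases hki : k = i
      · subst hki
        rw [Function.update_self] at hk
        rw [Function.update_of_ne (Ne.symm hkl)] at hl'
        exact key l x' (Ne.symm hkl) hk hl'
      · rw [Function.update_of_ne hki] at hk
        by_cases hli : l = i
        · subst hli
          rw [Function.update_self] at hl'
          exact (key k x' hki hl' hk).symm
        · rw [Function.update_of_ne hli] at hl'
          exact hJd k l x' hkl hk hl'
  have hle := hmax hmem (by
    intro k
    by_cases hk : k = i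
    · subst hk; simp
    · simp [hk]) i
  rw [Function.update_self] at hle
  exact hxi (hle (Or.inr (Metric.mem_ball_self hε)))

variable {S}

/-- Fullness says that adding the endpoints of the pieces adds nothing, so the carrier is a finite
union of closed pieces. -/
lemma isClosed_carrier [Finite ι] (hS : S.IsFull) : IsClosed S.carrier := by
  have : S.carrier = ⋃ i, {z | z.1 ∈ closure (S.dom i)} ∩ {z | S.height i z = 0} := by
    ext z
    simp only [mem_iUnion, mem_inter_iff, mem_ofPred_eq]
    constructor
    · rintro ⟨i, h, h'⟩
      exact ⟨i, subset_closure h, h'⟩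
    · rintro ⟨i, h, h'⟩
      exact hS i z h h'
  rw [this]
  exact isClosed_iUnion_of_finite fun i => (isClosed_closure.preimage continuous_fst).inter
    (isClosed_eq (S.continuous_height i) continuous_const)

/-- Two distinct pieces that touch lie on lines of distinct slopes. -/
lemma slope_ne_of_touch {i j : ι} {z : ℝ × ℝ} (hij : i ≠ j) (hi : z.1 ∈ closure (S.dom i))
    (hj : z.1 ∈ S.dom j) (hzi : S.height i z = 0) (hzj : S.height j z = 0) :
    S.slope i ≠ S.slope j := by
  intro hs
  -- Equal slopes would put both pieces on one line, where the open interval `dom j` around the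
  -- touching abscissa meets `dom i`.
  obtain ⟨x, hxj, hxi⟩ := mem_closure_iff.1 hi _ (S.isOpen_dom j) hj
  refine S.disj i j x hij hxi hxj ?_
  simp only [height] at hzi hzj
  rw [hs] at hzi ⊢
  linarith

lemma eq_of_touch {i j : ι} {z : ℝ × ℝ} (hi : z.1 ∈ S.dom i)
    (hj : z.1 ∈ S.dom j) (hzi : S.height i z = 0) (hzj : S.height j z = 0) : i = j := by
  by_contra h
  refine S.disj i j z.1 h hi hj ?_
  simp only [height] at hzi hzj
  linarith

/-! ### Visibility in the complement of the pieces -/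

variable (S) in
/-- Mutual visibility in the complement of the pieces. -/
def Visible (p q : ℝ × ℝ) : Prop := Disjoint (segment ℝ p q) S.carrier

lemma Visible.symm {p q : ℝ × ℝ} (h : S.Visible p q) : S.Visible q p := by
  rwa [Visible, segment_symm]

lemma visible_refl {p : ℝ × ℝ} (h : p ∉ S.carrier) : S.Visible p p := by
  simpa [Visible] using h

lemma Visible.left_notMem {p q : ℝ × ℝ} (h : S.Visible p q) : p ∉ S.carrier :=
  disjoint_left.1 h (left_mem_segment ℝ p q)

lemma Visible.right_notMem {p q : ℝ × ℝ} (h : S.Visible p q) : q ∉ S.carrier :=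
  disjoint_left.1 h (right_mem_segment ℝ p q)

lemma Visible.of_mem_segment {p q r : ℝ × ℝ} (h : S.Visible p q) (hr : r ∈ segment ℝ p q) :
    S.Visible p r :=
  h.mono_left ((convex_segment p q).segment_subset (left_mem_segment ℝ p q) hr)

lemma visible_of_convex {C : Set (ℝ × ℝ)} (hC : Convex ℝ C) (hd : Disjoint C S.carrier)
    {p q : ℝ × ℝ} (hp : p ∈ C) (hq : q ∈ C) : S.Visible p q :=
  hd.mono_left (hC.segment_subset hp hq)

/-- In the complement of a full segment system, visibility is transitive. -/
theorem Visible.trans [Finite ι] (hS : S.IsFull) {p q r : ℝ × ℝ} (hpq : S.Visible p q)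
    (hqr : S.Visible q r) : S.Visible p r := by
  by_contra hpr
  -- Sweep the triangle `p q r`: `F (t, ·)` runs from `p` to the point of `[q, r]` with parameter
  -- `t`. By compactness there is a least `t` for which this segment meets the carrier.
  let F : ℝ × ℝ → ℝ × ℝ := fun a => p + a.2 • (q + a.1 • (r - q) - p)
  have hF : Continuous F := by fun_prop
  let K : Set (ℝ × ℝ) := (Icc 0 1 ×ˢ Icc 0 1) ∩ F ⁻¹' S.carrier
  have hK : IsCompact K := (isCompact_Icc.prod isCompact_Icc).inter_right
    ((isClosed_carrier hS).preimage hF)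
  have hKne : K.Nonempty := by
    obtain ⟨z, hz, hzX⟩ := not_disjoint_iff.1 hpr
    rw [segment_eq_image'] at hz
    obtain ⟨s, hs, rfl⟩ := hz
    refine ⟨(1, s), ⟨⟨by simp, hs⟩, ?_⟩⟩
    simpa [F] using hzX
  obtain ⟨⟨t, s⟩, hts, hmin⟩ := hK.exists_isMinOn hKne continuous_fst.continuousOn
  have hmin' : ∀ t' s', t' < t → t' ∈ Icc (0 : ℝ) 1 → s' ∈ Icc (0 : ℝ) 1 → F (t', s') ∉ S.carrier := by
    intro t' s' hlt ht' hs' hX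
    exact absurd (hmin (show (t', s') ∈ K from ⟨⟨ht', hs'⟩, hX⟩)) (by simpa using hlt)
  obtain ⟨⟨ht, hs⟩, hX⟩ := hts
  simp only at ht hs
  have hpX : p ∉ S.carrier := hpq.left_notMem
  have ht0 : 0 < t := by
    refine lt_of_le_of_ne ht.1 fun h => ?_
    subst h
    refine disjoint_left.1 hpq ?_ hX
    rw [segment_eq_image']
    exact ⟨s, hs, by simp [F]⟩
  set w : ℝ × ℝ := q + t • (r - q) with hw
  have hwX : w ∉ S.carrier := by
    refine disjoint_left.1 hqr ?_
    rw [segment_eq_image']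
    exact ⟨t, ht, rfl⟩
  -- a piece met by the extremal segment is parallel to it
  have key : ∀ s ∈ Icc (0 : ℝ) 1, ∀ i, (F (t, s)).1 ∈ S.dom i → S.height i (F (t, s)) = 0 →
      (w - p).2 - S.slope i * (w - p).1 = 0 := by
    intro s hs i hi hz
    have hX : F (t, s) ∈ S.carrier := ⟨i, hi, hz⟩
    have hs0 : 0 < s := lt_of_le_of_ne hs.1 fun h => hpX (by subst h; simpa [F] using hX)
    have hs1 : s < 1 := lt_of_le_of_ne hs.2 fun h => hwX (by subst h; simpa [F, w] using hX)
    by_contra hne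
    -- `l t'` is the rate of change of `height i` along the segment with parameter `t'`. If it is
    -- nonzero at `t`, the segments with slightly smaller `t'` still meet piece `i`, at parameter `σ
    -- t'`, against the minimality of `t`.
    let l : ℝ → ℝ := fun t' => (q + t' • (r - q) - p).2 - S.slope i * (q + t' • (r - q) - p).1
    have hl : Continuous l := by fun_prop
    have hlt : l t ≠ 0 := hne
    let σ : ℝ → ℝ := fun t' => -S.height i p / l t'
    have hFh : ∀ t' s', S.height i (F (t', s')) = S.height i p + s' * l t' := by
      intro t' s'
      simp only [F, l, height, Prod.fst_add, Prod.snd_add, Prod.smul_fst, Prod.smul_snd,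
        Prod.fst_sub, Prod.snd_sub, smul_eq_mul]
      ring
    have hσt : σ t = s := by
      have := hFh t s
      rw [hz] at this
      simp only [σ]
      rw [div_eq_iff hlt]
      linarith
    have hσ : ContinuousAt σ t := continuousAt_const.div hl.continuousAt hlt
    have h1 : ∀ᶠ t' in 𝓝 t, σ t' ∈ Ioo (0 : ℝ) 1 :=
      hσ.eventually_mem (isOpen_Ioo.mem_nhds (by rw [hσt]; exact ⟨hs0, hs1⟩))
    have h2 : ∀ᶠ t' in 𝓝 t, (F (t', σ t')).1 ∈ S.dom i := by
      have hc : ContinuousAt (fun t' => (F (t', σ t')).1) t :=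
        (continuous_fst.comp hF).continuousAt.comp (continuousAt_id.prodMk hσ)
      exact hc.eventually_mem ((S.isOpen_dom i).mem_nhds (by rw [hσt]; exact hi))
    have h3 : ∀ᶠ t' in 𝓝 t, l t' ≠ 0 := hl.continuousAt.eventually_ne hlt
    have h4 : ∀ᶠ t' in 𝓝 t, 0 < t' := lt_mem_nhds ht0
    obtain ⟨t', ⟨⟨⟨h1, h2⟩, h3⟩, h4⟩, h5⟩ :=
      ((((h1.and h2).and h3).and h4).filter_mono nhdsWithin_le_nhds |>.and
        (self_mem_nhdsWithin (s := Iio t))).exists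
    have h5 : t' < t := h5
    refine hmin' t' (σ t') h5 ⟨h4.le, h5.le.trans ht.2⟩ (Ioo_subset_Icc_self h1) ⟨i, h2, ?_⟩
    rw [hFh]
    simp only [σ]
    field_simp
    ring
  obtain ⟨i, hi, hz⟩ := hX
  have hpar := key s hs i hi hz
  have hFt : ∀ s', F (t, s') = p + s' • (w - p) := fun s' => rfl
  have hline : ∀ s', S.height i (F (t, s')) = 0 := by
    intro s'
    have h1 := hz
    simp only [hFt, height, Prod.fst_add, Prod.snd_add, Prod.smul_fst, Prod.smul_snd,
        smul_eq_mul] at h1 ⊢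
    linear_combination h1 + (s' - s) * hpar
  have hwp : (w - p).1 ≠ 0 := by
    intro h
    have h' : w - p = 0 := by
      ext
      · exact h
      · simpa [h] using hpar
    apply hpX
    have : F (t, s) = p := by rw [hFt, h']; simp
    exact ⟨i, this ▸ hi, this ▸ hz⟩
  -- walk along piece `i` towards `p` up to its endpoint
  let x : ℝ → ℝ := fun s' => (F (t, s')).1
  have hx : Continuous x := by fun_prop
  let B : Set ℝ := Icc 0 s ∩ x ⁻¹' (S.dom i)ᶜ
  have hB : IsCompact B := isCompact_Icc.inter_right ((S.isOpen_dom i).isClosed_compl.preimage hx)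
  have h0B : (0 : ℝ) ∈ B := by
    refine ⟨⟨le_rfl, hs.1⟩, fun h => hpX ?_⟩
    have : F (t, 0) = p := by rw [hFt]; simp
    exact ⟨i, this ▸ h, this ▸ hline 0⟩
  obtain ⟨s₁, ⟨hs₁, hs₁'⟩, hmax⟩ := hB.exists_isMaxOn ⟨0, h0B⟩ continuous_id.continuousOn
  have hlt : s₁ < s := lt_of_le_of_ne hs₁.2 fun h => hs₁' (by subst h; exact hi)
  have hcl : x s₁ ∈ closure (S.dom i) := by
    have hsub : ∀ s' ∈ Ioc s₁ s, x s' ∈ S.dom i := by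
      intro s' hs'
      by_contra h
      exact absurd (hmax (show s' ∈ B from ⟨⟨hs₁.1.trans hs'.1.le, hs'.2⟩, h⟩))
        (by simpa using hs'.1)
    have : s₁ ∈ closure (Ioc s₁ s) := by rw [closure_Ioc hlt.ne]; exact ⟨le_rfl, hlt.le⟩
    exact map_mem_closure hx this hsub
  -- By fullness the end of piece `i` lies on another piece `j`. By `key` this piece is parallel to
  -- the same segment and hence to piece `i`, but touching pieces are never parallel.
  obtain ⟨j, hj, hzj⟩ := hS i (F (t, s₁)) hcl (hline s₁)
  have hij : i ≠ j := fun h => hs₁' (h ▸ hj)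
  refine slope_ne_of_touch hij hcl hj (hline s₁) hzj ?_
  have hpar' := key s₁ ⟨hs₁.1, hs₁.2.trans hs.2⟩ j hj hzj
  have : (S.slope i - S.slope j) * (w - p).1 = 0 := by linarith
  rcases mul_eq_zero.1 this with h | h
  · linarith
  · exact absurd h hwp

end SegmentSystem

/-! ### Counting the visibility classes -/

/-- If `ι`-many identifications make all points of `K` equal, then `K` has at most `|ι| + 1`
points. -/
lemma finite_and_card_le_of_forall_const {K ι : Type*} [Finite ι] (a b : ι → K)
    (h : ∀ f : K → Prop, (∀ i, f (a i) ↔ f (b i)) → ∀ k l, f k → f l) :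
    Finite K ∧ Nat.card K ≤ Nat.card ι + 1 := by
  rcases isEmpty_or_nonempty K with hK | ⟨⟨k₀⟩⟩
  · exact ⟨inferInstance, by simp⟩
  constructor
  · have hfin : ({k₀} ∪ range a ∪ range b : Set K).Finite :=
      ((finite_singleton k₀).union (finite_range a)).union (finite_range b)
    have huniv : (univ : Set K) ⊆ {k₀} ∪ range a ∪ range b := by
      intro l _
      exact h (· ∈ ({k₀} ∪ range a ∪ range b : Set K)) (fun i => by simp) k₀ l (by simp)
    exact finite_univ_iff.1 (hfin.subset huniv)
  · let Γ : SimpleGraph K := SimpleGraph.fromEdgeSet (range fun i => s(a i, b i))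
    have hr : ∀ i, Γ.Reachable (a i) (b i) := by
      intro i
      by_cases hab : a i = b i
      · rw [hab]
      · exact SimpleGraph.Adj.reachable (by
          rw [SimpleGraph.fromEdgeSet_adj]
          exact ⟨⟨i, rfl⟩, hab⟩)
    have hconn : Γ.Connected := by
      have : Nonempty K := ⟨k₀⟩
      refine SimpleGraph.Connected.mk fun k l => ?_
      exact h (Γ.Reachable k) (fun i => ⟨fun h => h.trans (hr i), fun h => h.trans (hr i).symm⟩)
        k l (SimpleGraph.Reachable.refl k)
    have h1 := hconn.card_vert_le_card_edgeSet_add_one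
    have h2 : Nat.card Γ.edgeSet ≤ Nat.card ι := by
      have hsub : Γ.edgeSet ⊆ range fun i => s(a i, b i) := by
        rw [SimpleGraph.edgeSet_fromEdgeSet]; exact sdiff_subset
      calc Nat.card Γ.edgeSet ≤ Nat.card (range fun i => s(a i, b i)) :=
            Nat.card_mono (finite_range _) hsub
        _ ≤ Nat.card ι := Finite.card_range_le _
    omega

namespace SegmentSystem

variable {ι : Type*} {S : SegmentSystem ι}

lemma height_add (i : ι) (x h : ℝ) : S.height i (x, S.slope i * x + S.icpt i + h) = h := by
  simp [height]

/-- Each piece has an initial part free of endpoints of other pieces. -/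
lemma exists_initial_part [Finite ι] (i : ι) :
    ∃ c ∈ S.dom i, ∀ x ∈ S.dom i, x ≤ c → ∀ k, k ≠ i → x ∈ closure (S.dom k) →
      S.height k (x, S.slope i * x + S.icpt i) ≠ 0 := by
  -- Each other piece ends on piece `i` in at most one point, because touching pieces have different
  -- slopes. So there are finitely many such abscissae, and `c` is taken to the left of all of them.
  let B : Set ℝ := {x | x ∈ S.dom i ∧ ∃ k, k ≠ i ∧ x ∈ closure (S.dom k) ∧
    S.height k (x, S.slope i * x + S.icpt i) = 0}
  have hB : B.Finite := by
    have : B ⊆ ⋃ k, {x | x ∈ S.dom i ∧ k ≠ i ∧ x ∈ closure (S.dom k) ∧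
        S.height k (x, S.slope i * x + S.icpt i) = 0} := by
      rintro x ⟨h, k, hk⟩
      exact mem_iUnion.2 ⟨k, h, hk⟩
    refine (finite_iUnion fun k => Set.Subsingleton.finite ?_).subset this
    rintro x ⟨hx, hk, hxk, hx0⟩ y ⟨hy, _, hyk, hy0⟩
    have hne := slope_ne_of_touch (z := (x, S.slope i * x + S.icpt i)) hk hxk hx hx0
      (by simp [height])
    simp only [height] at hx0 hy0
    have : (S.slope i - S.slope k) * (x - y) = 0 := by linarith
    rcases mul_eq_zero.1 this with h | h
    · exact absurd (by linarith) hne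
    · linarith
  suffices h : ∃ c ∈ S.dom i, ∀ x ∈ B, c < x by
    obtain ⟨c, hc, hcB⟩ := h
    refine ⟨c, hc, fun x hx hxc k hk hxk h0 => ?_⟩
    exact absurd (hcB x ⟨hx, k, hk, hxk, h0⟩) (not_lt.2 hxc)
  rcases B.eq_empty_or_nonempty with he | hne
  · obtain ⟨c, hc⟩ := S.nonempty_dom i
    exact ⟨c, hc, by simp [he]⟩
  · obtain ⟨x₀, hx₀, hmin⟩ := hB.isCompact.exists_isMinOn hne continuous_id.continuousOn
    have hev : ∀ᶠ c in 𝓝[<] x₀, c ∈ S.dom i :=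
      nhdsWithin_le_nhds ((S.isOpen_dom i).mem_nhds hx₀.1)
    obtain ⟨c, hc, hlt⟩ := (hev.and self_mem_nhdsWithin).exists
    exact ⟨c, hc, fun x hx => lt_of_lt_of_le hlt (hmin hx)⟩

/-- A sub-segment of a piece that avoids the other pieces has a strip around it meeting the
carrier only in that piece. -/
lemma exists_strip [Finite ι] (i : ι) {a c : ℝ} (hfree : ∀ x ∈ Icc a c, ∀ k, k ≠ i →
      x ∈ closure (S.dom k) → S.height k (x, S.slope i * x + S.icpt i) ≠ 0) :
    ∃ δ > 0, ∀ x ∈ Icc a c, ∀ h, |h| < δ → (x, S.slope i * x + S.icpt i + h) ∈ S.carrier →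
      h = 0 := by
  -- The closures of the other pieces form a closed set missing the compact sub-segment, so the tube
  -- lemma provides a uniform width.
  let Y : Set (ℝ × ℝ) := ⋃ k, {z | k ≠ i ∧ z.1 ∈ closure (S.dom k) ∧ S.height k z = 0}
  have hY : IsClosed Y := by
    refine isClosed_iUnion_of_finite fun k => ?_
    by_cases hk : k = i
    · simp [hk]
    · have : {z : ℝ × ℝ | k ≠ i ∧ z.1 ∈ closure (S.dom k) ∧ S.height k z = 0} =
          {z | z.1 ∈ closure (S.dom k)} ∩ {z | S.height k z = 0} := by
        ext z; simp [hk]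
      rw [this]
      exact (isClosed_closure.preimage continuous_fst).inter
        (isClosed_eq (S.continuous_height k) continuous_const)
  let g : ℝ × ℝ → ℝ × ℝ := fun a => (a.1, S.slope i * a.1 + S.icpt i + a.2)
  have hg : Continuous g := by fun_prop
  obtain ⟨u, v, hu, hv, hau, h0v, huv⟩ := generalized_tube_lemma (isCompact_Icc (a := a) (b := c))
    (isCompact_singleton (x := (0 : ℝ))) (hY.isOpen_compl.preimage hg) (by
      rintro ⟨x, h⟩ ⟨hx, hh⟩ hmem
      simp only [mem_singleton_iff] at hh
      subst hh
      obtain ⟨k, hk, hxk, h0⟩ := mem_iUnion.1 hmem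
      exact hfree x hx k hk hxk (by simpa [g] using h0))
  obtain ⟨δ, hδ, hball⟩ := Metric.isOpen_iff.1 hv 0 (h0v rfl)
  refine ⟨δ, hδ, fun x hx h hh hX => ?_⟩
  obtain ⟨k, hk, h0⟩ := hX
  by_cases hki : k = i
  · subst hki
    rwa [height_add] at h0
  · exact absurd (show g (x, h) ∈ Y from mem_iUnion.2 ⟨k, hki, subset_closure hk, h0⟩)
      (huv (mk_mem_prod (hau hx) (hball (by simpa using hh))))

lemma convex_strip (i : ι) (I T : Set ℝ) (hI : Convex ℝ I) (hT : Convex ℝ T) :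
    Convex ℝ {z : ℝ × ℝ | z.1 ∈ I ∧ S.height i z ∈ T} := by
  rintro z ⟨hz1, hz2⟩ w ⟨hw1, hw2⟩ α β hα hβ hαβ
  refine ⟨by simpa using hI hz1 hw1 hα hβ hαβ, ?_⟩
  have := hT hz2 hw2 hα hβ hαβ
  convert this using 1
  simp only [height, Prod.fst_add, Prod.snd_add, Prod.smul_fst, Prod.smul_snd, smul_eq_mul]
  linear_combination (-S.icpt i) * hαβ.symm

/-- Near its left end a piece has two well-defined sides, each within a single visibility class. -/
lemma exists_sides [Finite ι] (hS : S.IsFull) (i : ι) :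
    ∃ c ∈ S.dom i, ∃ u v : ℝ × ℝ, u ∉ S.carrier ∧ v ∉ S.carrier ∧
      ∀ z : ℝ × ℝ, z.1 ∈ S.dom i → S.height i z = 0 → z.1 < c →
        ∀ᶠ w in 𝓝 z, w ∉ S.carrier → S.Visible w u ∨ S.Visible w v := by
  obtain ⟨c, hc, hfree⟩ := S.exists_initial_part i
  obtain ⟨δ₀, hδ₀, hstrip₀⟩ := S.exists_strip i (a := c) (c := c) (fun x hx => by
    have : x = c := le_antisymm hx.2 hx.1
    subst this
    exact hfree x hc le_rfl)
  have hcc : c ∈ Icc c c := ⟨le_rfl, le_rfl⟩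
  -- The reference points lie above and below `c`, within a width that is free over `c` alone. They
  -- must be fixed before `z`, whereas the free width over `[a, c]` may shrink as `a` moves left.
  refine ⟨c, hc, (c, S.slope i * c + S.icpt i + δ₀ / 2), (c, S.slope i * c + S.icpt i + -(δ₀ / 2)),
    fun h => ?_, fun h => ?_, ?_⟩
  · have := hstrip₀ c hcc _ (by rw [abs_of_pos] <;> linarith) h
    linarith
  · have := hstrip₀ c hcc _ (by rw [abs_neg, abs_of_pos] <;> linarith) h
    linarith
  intro z hz hz0 hzc
  obtain ⟨a, haz, ha⟩ : ∃ a < z.1, a ∈ S.dom i := by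
    have hev : ∀ᶠ c in 𝓝[<] z.1, c ∈ S.dom i :=
      nhdsWithin_le_nhds ((S.isOpen_dom i).mem_nhds hz)
    obtain ⟨a, h, h'⟩ := (hev.and self_mem_nhdsWithin).exists
    exact ⟨a, h', h⟩
  obtain ⟨δ, hδ, hstrip⟩ := S.exists_strip i (a := a) (c := c)
    (fun x hx => hfree x ((S.ordConnected_dom i).out ha hc hx) hx.2)
  have hh : ∀ᶠ w in 𝓝 z, S.height i w ∈ Ioo (-δ) δ :=
    (S.continuous_height i).continuousAt.eventually_mem
      (isOpen_Ioo.mem_nhds (by rw [hz0]; constructor <;> linarith))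
  have hx : ∀ᶠ w in 𝓝 z, w.1 ∈ Ioo a c :=
    continuous_fst.continuousAt.eventually_mem (isOpen_Ioo.mem_nhds ⟨haz, hzc⟩)
  -- half strips are free of pieces
  have side : ∀ (T : Set ℝ), Convex ℝ T → (0 : ℝ) ∉ T → ∀ (I : Set ℝ), Convex ℝ I → ∀ η,
      (∀ x ∈ I, ∀ h, |h| < η → (x, S.slope i * x + S.icpt i + h) ∈ S.carrier → h = 0) →
      (∀ h ∈ T, |h| < η) →
      ∀ p q : ℝ × ℝ, p.1 ∈ I → q.1 ∈ I → S.height i p ∈ T → S.height i q ∈ T → S.Visible p q := by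
    intro T hT h0 I hI η hη hTη p q hp hq hpT hqT
    refine visible_of_convex (S.convex_strip i I T hI hT) ?_ ⟨hp, hpT⟩ ⟨hq, hqT⟩
    rw [disjoint_left]
    rintro w ⟨hwI, hwT⟩ hwX
    have hw : w = (w.1, S.slope i * w.1 + S.icpt i + S.height i w) := by
      ext
      · rfl
      · simp [height]
    rw [hw] at hwX
    exact h0 (hη w.1 hwI _ (hTη _ hwT) hwX ▸ hwT)
  have habs : ∀ η h : ℝ, h ∈ Ioo 0 η → |h| < η := fun η h hh => by
    rw [abs_of_pos hh.1]; exact hh.2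
  have habs' : ∀ η h : ℝ, h ∈ Ioo (-η) 0 → |h| < η := fun η h hh => by
    rw [abs_of_neg hh.2]; linarith [hh.1]
  have hac : a ≤ c := (haz.trans hzc).le
  filter_upwards [hh, hx] with w hw hwx hwX
  have hw0 : S.height i w ≠ 0 := fun h => hwX ⟨i, (S.ordConnected_dom i).out ha hc
    (Ioo_subset_Icc_self hwx), h⟩
  -- A width that suits both strips: the point over `c` at height `±μ / 2` is seen from `w` inside
  -- the strip over `[a, c]`, and sees the reference point along the vertical line over `c`.
  set μ := min δ δ₀ with hμ
  have hμ0 : 0 < μ := lt_min hδ hδ₀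
  have hμ1 : μ ≤ δ := min_le_left _ _
  have hμ2 : μ ≤ δ₀ := min_le_right _ _
  rcases lt_or_gt_of_ne hw0 with hneg | hpos
  · right
    refine Visible.trans hS (q := (c, S.slope i * c + S.icpt i + -(μ / 2))) ?_ ?_
    · refine side (Ioo (-δ) 0) (convex_Ioo _ _) (by simp) (Icc a c) (convex_Icc _ _) δ hstrip
        (habs' δ) w _ (Ioo_subset_Icc_self hwx) ⟨hac, le_rfl⟩ ⟨hw.1, hneg⟩ ?_
      rw [height_add]; constructor <;> linarith
    · refine side (Ioo (-δ₀) 0) (convex_Ioo _ _) (by simp) (Icc c c) (convex_Icc _ _) δ₀ hstrip₀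
        (habs' δ₀) _ _ hcc hcc ?_ ?_
      · rw [height_add]; constructor <;> linarith
      · rw [height_add]; constructor <;> linarith
  · left
    refine Visible.trans hS (q := (c, S.slope i * c + S.icpt i + μ / 2)) ?_ ?_
    · refine side (Ioo 0 δ) (convex_Ioo _ _) (by simp) (Icc a c) (convex_Icc _ _) δ hstrip
        (habs δ) w _ (Ioo_subset_Icc_self hwx) ⟨hac, le_rfl⟩ ⟨hpos, hw.2⟩ ?_
      rw [height_add]; constructor <;> linarith
    · refine side (Ioo 0 δ₀) (convex_Ioo _ _) (by simp) (Icc c c) (convex_Icc _ _) δ₀ hstrip₀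
        (habs δ₀) _ _ hcc hcc ?_ ?_
      · rw [height_add]; constructor <;> linarith
      · rw [height_add]; constructor <;> linarith

/-- No piece is vertical, so a vertical line meets the carrier in finitely many points. -/
lemma dense_compl_carrier [Finite ι] (S : SegmentSystem ι) : Dense (S.carrier)ᶜ := by
  intro z
  rw [mem_closure_iff_frequently]
  have hfin : {y : ℝ | (z.1, y) ∈ S.carrier}.Finite := by
    have : {y : ℝ | (z.1, y) ∈ S.carrier} ⊆ range fun i => S.slope i * z.1 + S.icpt i := by
      rintro y ⟨i, -, h⟩
      refine ⟨i, ?_⟩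
      simp only [height] at h
      linarith
    exact (finite_range _).subset this
  have hd : Dense ({y : ℝ | (z.1, y) ∈ S.carrier})ᶜ := hfin.countable.dense_compl ℝ
  have h1 := mem_closure_iff_frequently.1 (hd z.2)
  have hc : Tendsto (fun y : ℝ => (z.1, y)) (𝓝 z.2) (𝓝 z) := by
    have : Continuous fun y : ℝ => (z.1, y) := by fun_prop
    exact this.tendsto z.2
  exact hc.frequently h1

/-- The leftmost-point argument: a two-colouring of the complement of the carrier that is constant
on visibility classes and agrees on both sides of every left end is constant. -/
theorem colour_const [Finite ι] (hS : S.IsFull) (c : ι → ℝ) (u v : ι → ℝ × ℝ)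
    (hc : ∀ i, c i ∈ S.dom i)
    (huv : ∀ i, ∀ z : ℝ × ℝ, z.1 ∈ S.dom i → S.height i z = 0 → z.1 < c i →
        ∀ᶠ w in 𝓝 z, w ∉ S.carrier → S.Visible w (u i) ∨ S.Visible w (v i))
    (f : ℝ × ℝ → Prop) (hf : ∀ p q, S.Visible p q → f p → f q) (hfi : ∀ i, f (u i) ↔ f (v i))
    {p q : ℝ × ℝ} (hp : p ∉ S.carrier) (hq : q ∉ S.carrier) (hfp : f p) : f q := by
  by_contra hfq
  have hX := isClosed_carrier hS
  have hloc : ∀ z ∉ S.carrier, ∀ᶠ w in 𝓝 z, S.Visible z w := by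
    intro z hz
    obtain ⟨ε, hε, hball⟩ := Metric.isOpen_iff.1 hX.isOpen_compl z hz
    filter_upwards [Metric.ball_mem_nhds z hε] with w hw
    exact visible_of_convex (convex_ball z ε) (disjoint_left.2 fun a ha => hball ha)
      (Metric.mem_ball_self hε) hw
  -- The colour classes `A` and `B` are open, disjoint and together dense. If both are nonempty,
  -- connectedness of the plane makes their closures meet, in a frontier `F` contained in the
  -- carrier.
  let A : Set (ℝ × ℝ) := {z | z ∉ S.carrier ∧ f z}
  let B : Set (ℝ × ℝ) := {z | z ∉ S.carrier ∧ ¬ f z}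
  have hA : IsOpen A := by
    rw [isOpen_iff_mem_nhds]
    rintro z ⟨hz, hfz⟩
    filter_upwards [hloc z hz] with w hw
    exact ⟨hw.right_notMem, hf _ _ hw hfz⟩
  have hB : IsOpen B := by
    rw [isOpen_iff_mem_nhds]
    rintro z ⟨hz, hfz⟩
    filter_upwards [hloc z hz] with w hw
    exact ⟨hw.right_notMem, fun h => hfz (hf _ _ hw.symm h)⟩
  have hAB : Disjoint A B := disjoint_left.2 fun z h h' => h'.2 h.2
  have hcover : closure A ∪ closure B = univ := by
    rw [← closure_union, ← (dense_compl_carrier S).closure_eq]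
    congr 1
    ext z
    simp only [A, B, mem_union, mem_ofPred_eq, mem_compl_iff]
    tauto
  let F : Set (ℝ × ℝ) := closure A ∩ closure B
  have hFcl : IsClosed F := isClosed_closure.inter isClosed_closure
  have hFX : F ⊆ S.carrier := by
    rintro z ⟨hzA, hzB⟩
    by_contra hz
    by_cases hfz : f z
    · exact disjoint_left.1 (hAB.closure_right hA) ⟨hz, hfz⟩ hzB
    · exact disjoint_left.1 (hAB.closure_left hB) hzA ⟨hz, hfz⟩
  have hFne : F.Nonempty := by
    have := isPreconnected_closed_iff.1 (isPreconnected_univ (α := ℝ × ℝ)) (closure A) (closure B)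
      isClosed_closure isClosed_closure hcover.ge ⟨p, trivial, subset_closure ⟨hp, hfp⟩⟩
      ⟨q, trivial, subset_closure ⟨hq, hfq⟩⟩
    simpa using this
  -- The frontier avoids the initial part of every piece, whose two sides carry the colours of `u i`
  -- and `v i` and hence the same colour. This bounds `F` on the left, so that a leftmost point
  -- exists even if pieces are unbounded.
  have hleft : ∀ i, ∀ z ∈ F, z.1 ∈ S.dom i → S.height i z = 0 → c i ≤ z.1 := by
    rintro i z ⟨hzA, hzB⟩ hzi hz0
    by_contra hlt
    have hev := huv i z hzi hz0 (not_le.1 hlt)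
    obtain ⟨a, ha, ha'⟩ := ((mem_closure_iff_frequently.1 hzA).and_eventually hev).exists
    obtain ⟨b, hb, hb'⟩ := ((mem_closure_iff_frequently.1 hzB).and_eventually hev).exists
    have h1 : f (u i) := by
      rcases ha' ha.1 with h | h
      · exact hf _ _ h ha.2
      · exact (hfi i).2 (hf _ _ h ha.2)
    apply hb.2
    rcases hb' hb.1 with h | h
    · exact hf _ _ h.symm h1
    · exact hf _ _ h.symm ((hfi i).1 h1)
  -- a leftmost point of the frontier
  obtain ⟨z, hzF, hzmin⟩ : ∃ z ∈ F, ∀ w ∈ F, z.1 ≤ w.1 := by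
    obtain ⟨z₀, hz₀⟩ := hFne
    have hK : IsCompact (⋃ i, (fun x => (x, S.slope i * x + S.icpt i)) '' Icc (c i) z₀.1) :=
      isCompact_iUnion fun i => isCompact_Icc.image (by fun_prop)
    have hsub : F ∩ {w | w.1 ≤ z₀.1} ⊆
        ⋃ i, (fun x => (x, S.slope i * x + S.icpt i)) '' Icc (c i) z₀.1 := by
      rintro w ⟨hwF, hw⟩
      obtain ⟨i, hi, h0⟩ := hFX hwF
      refine mem_iUnion.2 ⟨i, w.1, ⟨hleft i w hwF hi h0, hw⟩, ?_⟩
      ext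
      · rfl
      · simp only [height] at h0 ⊢
        linarith
    have hK' : IsCompact (F ∩ {w | w.1 ≤ z₀.1}) := hK.of_isClosed_subset
      (hFcl.inter (isClosed_le continuous_fst continuous_const)) hsub
    obtain ⟨z, hz, hmin⟩ := hK'.exists_isMinOn ⟨z₀, hz₀, le_refl z₀.1⟩
      continuous_fst.continuousOn
    refine ⟨z, hz.1, fun w hw => ?_⟩
    by_cases h : w.1 ≤ z₀.1
    · exact hmin ⟨hw, h⟩
    · exact hz.2.trans (not_le.1 h).le
  obtain ⟨j, hj, hz0⟩ := hFX hzF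
  -- near `z` the frontier lies on piece `j`
  have hnear : ∀ᶠ w in 𝓝 z, w ∈ F → S.height j w = 0 := by
    have h1 : ∀ᶠ w in 𝓝 z, ∀ k, k ≠ j → z.1 < c k → w.1 < c k := by
      rw [eventually_all]
      intro k
      by_cases h : z.1 < c k
      · filter_upwards [(continuous_fst.tendsto z).eventually (gt_mem_nhds h)] with w hw _ _
        exact hw
      · exact Eventually.of_forall fun w _ h' => absurd h' h
    have h2 : ∀ᶠ w in 𝓝 z, ∀ k, (z.1 ∈ closure (S.dom k) → S.height k z ≠ 0) →
        w.1 ∈ S.dom k → S.height k w ≠ 0 := by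
      rw [eventually_all]
      intro k
      by_cases hz' : z.1 ∈ closure (S.dom k)
      · by_cases hk : S.height k z = 0
        · exact Eventually.of_forall fun w h => absurd hk (h hz')
        · filter_upwards [(S.continuous_height k).continuousAt.eventually_ne hk] with w hw _ _
          exact hw
      · filter_upwards [continuous_fst.continuousAt.eventually_mem
          (isClosed_closure.isOpen_compl.mem_nhds hz')] with w hw _ hwk
        exact absurd (subset_closure hwk) hw
    filter_upwards [h1, h2] with w hw1 hw2 hwF
    obtain ⟨k, hk, hk0⟩ := hFX hwF
    by_cases hkj : k = j
    · exact hkj ▸ hk0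
    exfalso
    by_cases htouch : z.1 ∈ closure (S.dom k) ∧ S.height k z = 0
    -- Piece `k` ends at `z` and its frontier point `w` lies to the right of `z`. So `z` is the left
    -- end of piece `k`, and `w` lies in its initial part, which `hleft` excludes.
    · have hzk : z.1 ∉ S.dom k := fun h => hkj (eq_of_touch h hj htouch.2 hz0)
      have hlt : z.1 < w.1 := lt_of_le_of_ne (hzmin w hwF) fun h => hzk (h ▸ hk)
      have hzc : z.1 < c k := by
        by_contra hle
        rw [not_lt] at hle
        exact hzk ((S.ordConnected_dom k).out (hc k) hk ⟨hle, hlt.le⟩)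
      exact absurd (hleft k w hwF hk hk0) (not_le.2 (hw1 k hkj hzc))
    · exact hw2 k (fun h h' => htouch ⟨h, h'⟩) hk hk0
  have hdom : ∀ᶠ w in 𝓝 z, w.1 ∈ S.dom j :=
    continuous_fst.continuousAt.eventually_mem ((S.isOpen_dom j).mem_nhds hj)
  obtain ⟨ε, hε, hball⟩ := Metric.eventually_nhds_iff_ball.1 (hnear.and hdom)
  -- a small parallelogram around `z`
  obtain ⟨η, hη, hN⟩ : ∃ η > 0, ∀ w : ℝ × ℝ, |w.1 - z.1| < η → |S.height j w| < η →
      w ∈ Metric.ball z ε := by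
    have hcont : ContinuousAt (fun a : ℝ × ℝ => (a.1, S.slope j * a.1 + S.icpt j + a.2))
        (z.1, 0) := by fun_prop
    have hz' : (fun a : ℝ × ℝ => (a.1, S.slope j * a.1 + S.icpt j + a.2)) (z.1, 0) = z := by
      ext
      · rfl
      · simp only [height] at hz0 ⊢
        linarith
    have hev := hcont.eventually_mem (s := Metric.ball z ε)
      (hz'.symm ▸ Metric.ball_mem_nhds z hε)
    obtain ⟨η, hη, h⟩ := Metric.eventually_nhds_iff_ball.1 hev
    refine ⟨η, hη, fun w hw hh => ?_⟩
    have := h (w.1, S.height j w) (by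
      rw [Metric.mem_ball, Prod.dist_eq, max_lt_iff]
      exact ⟨by simpa [Real.dist_eq] using hw, by simpa [Real.dist_eq] using hh⟩)
    convert this using 1
    ext
    · rfl
    · simp [height]
  let I : Set ℝ := Ioo (z.1 - η) (z.1 + η)
  let strip : Set ℝ → Set ℝ → Set (ℝ × ℝ) := fun I T => {w | w.1 ∈ I ∧ S.height j w ∈ T}
  -- The parallelogram without the part of line `j` from `z` to the right. It is connected and, `z`
  -- being leftmost, free of frontier points; yet it contains points of both colours.
  let Y : Set (ℝ × ℝ) := (strip I (Ioo 0 η) ∪ strip (Ioo (z.1 - η) z.1) (Ioo (-η) η)) ∪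
    strip I (Ioo (-η) 0)
  have hpre : ∀ a b T, Convex ℝ T → IsPreconnected (strip (Ioo a b) T) := fun a b T hT =>
    (S.convex_strip j _ _ (convex_Ioo a b) hT).isPreconnected
  have hpt : ∀ h, S.height j (z.1 - η / 2, S.slope j * (z.1 - η / 2) + S.icpt j + h) = h :=
    fun h => height_add _ _ _
  have hYpre : IsPreconnected Y := by
    refine IsPreconnected.union
      (z.1 - η / 2, S.slope j * (z.1 - η / 2) + S.icpt j + -(η / 2)) ?_ ?_
      (IsPreconnected.union (z.1 - η / 2, S.slope j * (z.1 - η / 2) + S.icpt j + η / 2) ?_ ?_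
        (hpre _ _ _ (convex_Ioo _ _)) (hpre _ _ _ (convex_Ioo _ _))) (hpre _ _ _ (convex_Ioo _ _))
    · right
      refine ⟨⟨by linarith, by linarith⟩, ?_⟩
      rw [hpt]; constructor <;> linarith
    · refine ⟨⟨by linarith, by linarith⟩, ?_⟩
      rw [hpt]; constructor <;> linarith
    · refine ⟨⟨by linarith, by linarith⟩, ?_⟩
      rw [hpt]; constructor <;> linarith
    · refine ⟨⟨by linarith, by linarith⟩, ?_⟩
      rw [hpt]; constructor <;> linarith
  have hYF : ∀ w ∈ Y, w ∉ F := by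
    intro w hw hwF
    have hw' : |w.1 - z.1| < η ∧ |S.height j w| < η ∧ (S.height j w ≠ 0 ∨ w.1 < z.1) := by
      rw [abs_lt, abs_lt]
      rcases hw with (⟨h1, h2⟩ | ⟨h1, h2⟩) | ⟨h1, h2⟩
      · exact ⟨⟨by linarith [h1.1], by linarith [h1.2]⟩, ⟨by linarith [h2.1], h2.2⟩,
          Or.inl h2.1.ne'⟩
      · exact ⟨⟨by linarith [h1.1], by linarith [h1.2]⟩, ⟨h2.1, h2.2⟩, Or.inr h1.2⟩
      · exact ⟨⟨by linarith [h1.1], by linarith [h1.2]⟩, ⟨h2.1, by linarith [h2.2]⟩,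
          Or.inl h2.2.ne⟩
    rcases hw'.2.2 with h | h
    · exact h ((hball w (hN w hw'.1 hw'.2.1)).1 hwF)
    · exact absurd (hzmin w hwF) (not_le.2 h)
  have hin : ∀ᶠ w in 𝓝 z, w ∉ S.carrier → w ∈ Y := by
    have h1 : ∀ᶠ w in 𝓝 z, w.1 ∈ I := continuous_fst.continuousAt.eventually_mem
      (isOpen_Ioo.mem_nhds ⟨by linarith, by linarith⟩)
    have h2 : ∀ᶠ w in 𝓝 z, S.height j w ∈ Ioo (-η) η :=
      (S.continuous_height j).continuousAt.eventually_mem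
        (isOpen_Ioo.mem_nhds (by rw [hz0]; constructor <;> linarith))
    filter_upwards [h1, h2, hdom] with w hw1 hw2 hw3 hwX
    have hne : S.height j w ≠ 0 := fun h => hwX ⟨j, hw3, h⟩
    rcases lt_or_gt_of_ne hne with h | h
    · exact Or.inr ⟨hw1, hw2.1, h⟩
    · exact Or.inl (Or.inl ⟨hw1, h, hw2.2⟩)
  obtain ⟨a, ha, ha'⟩ := ((mem_closure_iff_frequently.1 hzF.1).and_eventually hin).exists
  obtain ⟨b, hb, hb'⟩ := ((mem_closure_iff_frequently.1 hzF.2).and_eventually hin).exists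
  obtain ⟨w, hwY, hwF⟩ := isPreconnected_closed_iff.1 hYpre (closure A) (closure B)
    isClosed_closure isClosed_closure (by rw [hcover]; exact subset_univ _)
    ⟨a, ha' ha.1, subset_closure ha⟩ ⟨b, hb' hb.1, subset_closure hb⟩
  exact hYF w hwY hwF

/-- Visibility as an equivalence relation on the complement of a full segment system. -/
def visibleSetoid [Finite ι] (hS : S.IsFull) : Setoid {z : ℝ × ℝ // z ∉ S.carrier} where
  r p q := S.Visible p q
  iseqv := ⟨fun p => visible_refl p.2, Visible.symm, Visible.trans hS⟩

/-- A full system of `k` pieces cuts the plane into at most `k + 1` visibility classes. -/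
theorem finite_and_card_quotient_le [Finite ι] (hS : S.IsFull) :
    Finite (Quotient (visibleSetoid hS)) ∧
      Nat.card (Quotient (visibleSetoid hS)) ≤ Nat.card ι + 1 := by
  choose c hc u v hu hv huv using S.exists_sides hS
  refine finite_and_card_le_of_forall_const (fun i => Quotient.mk (visibleSetoid hS) ⟨u i, hu i⟩)
    (fun i => Quotient.mk (visibleSetoid hS) ⟨v i, hv i⟩) fun f hf k l hk => ?_
  induction k using Quotient.inductionOn with | h p => ?_
  induction l using Quotient.inductionOn with | h q => ?_
  let g : ℝ × ℝ → Prop := fun z => ∃ h : z ∉ S.carrier, f (Quotient.mk (visibleSetoid hS) ⟨z, h⟩)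
  have hg : ∀ z (h : z ∉ S.carrier), g z ↔ f (Quotient.mk (visibleSetoid hS) ⟨z, h⟩) :=
    fun z h => ⟨fun ⟨_, h'⟩ => h', fun h' => ⟨h, h'⟩⟩
  have := colour_const hS c u v hc huv g (fun a b hab ⟨ha, hfa⟩ => ⟨hab.right_notMem, by
      rwa [← Quotient.sound (s := visibleSetoid hS) (a := ⟨a, ha⟩) (b := ⟨b, hab.right_notMem⟩) hab]⟩)
    (fun i => by rw [hg _ (hu i), hg _ (hv i)]; exact hf i) p.2 q.2 ⟨p.2, hk⟩
  exact (hg _ q.2).1 this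

end SegmentSystem

/-! ### Convex cells and the number of cells at a point -/

namespace SegmentSystem

variable {ι : Type*} {S : SegmentSystem ι}

/-- The complement of a full system of `k` pieces is a disjoint union of at most `k + 1` convex
cells. -/
theorem exists_convex_cells [Finite ι] (hS : S.IsFull) :
    ∃ (K : Type) (_ : Finite K) (C : K → Set (ℝ × ℝ)), Nat.card K ≤ Nat.card ι + 1 ∧
      (∀ k, Convex ℝ (C k)) ∧ Pairwise (fun k l => Disjoint (C k) (C l)) ∧
      ⋃ k, C k = (S.carrier)ᶜ := by
  obtain ⟨hfin, hcard⟩ := finite_and_card_quotient_le hS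
  refine ⟨_, hfin, fun k => {z | ∃ h : z ∉ S.carrier, Quotient.mk (visibleSetoid hS) ⟨z, h⟩ = k},
    hcard, ?_, ?_, ?_⟩
  · intro k
    rw [convex_iff_segment_subset]
    rintro x ⟨hx, hxk⟩ y ⟨hy, hyk⟩ z hz
    have hxy : S.Visible x y := Quotient.exact (hxk.trans hyk.symm)
    have hxz : S.Visible x z := hxy.of_mem_segment hz
    refine ⟨hxz.right_notMem, ?_⟩
    rw [← hxk]
    exact (Quotient.sound (s := visibleSetoid hS) (a := ⟨x, hx⟩) (b := ⟨z, hxz.right_notMem⟩)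
      hxz).symm
  · intro k l hkl
    rw [Set.disjoint_left]
    rintro z ⟨h, hk⟩ ⟨h', hl⟩
    exact hkl (hk.symm.trans hl)
  · ext z
    simp

/-- A convex cell cannot accumulate at `z` from both sides of a piece inside a region where the
piece fills its line near `z`. -/
lemma not_both_sides {C D : Set (ℝ × ℝ)} (hC : Convex ℝ C) (hCX : Disjoint C S.carrier)
    (hD : Convex ℝ D) {i : ι} {z : ℝ × ℝ} {κ : ℝ}
    (hκ : κ ≠ 0) (hev : ∀ᶠ w in 𝓝 z, w ∈ D → S.height i w = 0 → w.1 ∈ S.dom i)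
    (h₁ : z ∈ closure (C ∩ (D ∩ {w | 0 < κ * S.height i w})))
    (h₂ : z ∈ closure (C ∩ (D ∩ {w | κ * S.height i w < 0}))) : False := by
  obtain ⟨ε, hε, hball⟩ := Metric.eventually_nhds_iff_ball.1 hev
  obtain ⟨a, ha, haC, haD, ha0⟩ := mem_closure_iff.1 h₁ _ Metric.isOpen_ball
    (Metric.mem_ball_self hε)
  obtain ⟨b, hb, hbC, hbD, hb0⟩ := mem_closure_iff.1 h₂ _ Metric.isOpen_ball
    (Metric.mem_ball_self hε)
  -- The segment from `a` to `b` stays in `C` and in `D`, and it crosses line `i` at a point that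
  -- belongs to piece `i`.
  obtain ⟨w, hw, hw0⟩ := (convex_segment a b).isPreconnected.intermediate_value
    (right_mem_segment ℝ a b) (left_mem_segment ℝ a b) (f := fun w => κ * S.height i w)
    (continuous_const.mul (S.continuous_height i)).continuousOn ⟨hb0.le, ha0.le⟩
  have hw0 : S.height i w = 0 := by
    rcases mul_eq_zero.1 hw0 with h | h
    · exact absurd h hκ
    · exact h
  exact disjoint_left.1 hCX (hC.segment_subset haC hbC hw)
    ⟨i, hball w ((convex_ball z ε).segment_subset ha hb hw) (hD.segment_subset haD hbD hw) hw0, hw0⟩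

/-- The cells together are dense in the open set `R`; since there are finitely many, a single one of
them accumulates at `z` inside `R`. -/
lemma exists_cell_of_region [Finite ι] {K : Type} [Finite K] {C : K → Set (ℝ × ℝ)}
    (hcov : ⋃ k, C k = (S.carrier)ᶜ) {R : Set (ℝ × ℝ)} (hR : IsOpen R) {z : ℝ × ℝ}
    (hz : z ∈ closure R) : ∃ k, z ∈ closure (C k ∩ R) := by
  have h1 : R ⊆ closure (R ∩ S.carrierᶜ) := (dense_compl_carrier S).open_subset_closure_inter hR
  have h2 : z ∈ closure (R ∩ S.carrierᶜ) := closure_minimal h1 isClosed_closure hz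
  rw [← hcov, inter_iUnion, closure_iUnion_of_finite, mem_iUnion] at h2
  obtain ⟨k, hk⟩ := h2
  exact ⟨k, by rwa [inter_comm]⟩

lemma mem_closure_of_direction {R : Set (ℝ × ℝ)} {z : ℝ × ℝ} (d : ℝ × ℝ)
    (h : ∀ t : ℝ, 0 < t → z + t • d ∈ R) : z ∈ closure R := by
  have hc : Continuous fun t : ℝ => z + t • d := by fun_prop
  have h0 : (0 : ℝ) ∈ closure (Ioi (0 : ℝ)) := by rw [closure_Ioi]; exact self_mem_Ici
  simpa using map_mem_closure hc h0 (fun t ht => h t ht)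

lemma height_add_smul (i : ι) (z d : ℝ × ℝ) (t : ℝ) :
    S.height i (z + t • d) = S.height i z + t * (d.2 - S.slope i * d.1) := by
  simp only [height, Prod.fst_add, Prod.snd_add, Prod.smul_fst, Prod.smul_snd, smul_eq_mul]
  ring

lemma convex_halfPlane (i : ι) (κ : ℝ) : Convex ℝ {w | 0 < κ * S.height i w} := by
  convert S.convex_strip i univ {t | 0 < κ * t} convex_univ ?_ using 1
  · ext w; simp
  · intro a ha b hb α β hα hβ hαβ
    have ha' : 0 < κ * a := ha
    have hb' : 0 < κ * b := hb
    have : 0 < α * (κ * a) + β * (κ * b) := by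
      rcases hα.eq_or_lt with h | h
      · subst h
        have : β = 1 := by linarith
        subst this
        linarith
      · have h1 := mul_pos h ha'
        have h2 := mul_nonneg hβ hb'.le
        linarith
    simp only [smul_eq_mul, mem_ofPred_eq]
    nlinarith

lemma isOpen_pos (i : ι) (κ : ℝ) : IsOpen {w | 0 < κ * S.height i w} :=
  isOpen_lt continuous_const (continuous_const.mul (S.continuous_height i))

lemma isOpen_neg (i : ι) (κ : ℝ) : IsOpen {w | κ * S.height i w < 0} :=
  isOpen_lt (continuous_const.mul (S.continuous_height i)) continuous_const

lemma mem_closure_neg {i : ι} {z : ℝ × ℝ} {κ : ℝ} (hκ : κ ≠ 0) (hz : S.height i z = 0) :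
    z ∈ closure {w | κ * S.height i w < 0} := by
  refine mem_closure_of_direction (0, -κ) fun t ht => ?_
  simp only [mem_ofPred_eq, height_add_smul, hz]
  have : 0 < κ ^ 2 := by positivity
  nlinarith

/-- A point on a piece is in the closure of at least two cells. -/
theorem two_cells [Finite ι] {K : Type} [Finite K] {C : K → Set (ℝ × ℝ)}
    (hconv : ∀ k, Convex ℝ (C k)) (hcov : ⋃ k, C k = (S.carrier)ᶜ) {z : ℝ × ℝ}
    (hz : z ∈ S.carrier) : ∃ k l, k ≠ l ∧ z ∈ closure (C k) ∧ z ∈ closure (C l) := by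
  have hCX : ∀ k, Disjoint (C k) S.carrier := fun k =>
    disjoint_left.2 fun w hw => by
      have : w ∈ ⋃ k, C k := mem_iUnion.2 ⟨k, hw⟩
      rw [hcov] at this
      exact this
  obtain ⟨i, hi, h0⟩ := hz
  obtain ⟨k, hk⟩ := exists_cell_of_region hcov (isOpen_neg (S := S) i 1)
    (mem_closure_neg one_ne_zero h0)
  obtain ⟨l, hl⟩ := exists_cell_of_region hcov (isOpen_neg (S := S) i (-1))
    (mem_closure_neg (by norm_num) h0)
  refine ⟨k, l, ?_, closure_mono inter_subset_left hk, closure_mono inter_subset_left hl⟩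
  rintro rfl
  have hev : ∀ᶠ w in 𝓝 z, w ∈ univ → S.height i w = 0 → w.1 ∈ S.dom i := by
    filter_upwards [continuous_fst.continuousAt.eventually_mem ((S.isOpen_dom i).mem_nhds hi)]
      with w hw _ _
    exact hw
  refine not_both_sides (hconv k) (hCX k) convex_univ one_ne_zero hev ?_ ?_
  · convert hl using 4
    simp
  · convert hk using 3
    simp

/-- A point where a piece ends on another piece is in the closure of at least three cells. -/
theorem three_cells [Finite ι] {K : Type} [Finite K] {C : K → Set (ℝ × ℝ)}
    (hconv : ∀ k, Convex ℝ (C k)) (hcov : ⋃ k, C k = (S.carrier)ᶜ) {z : ℝ × ℝ} {i e : ι}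
    (hie : e ≠ i) (hi : z.1 ∈ S.dom i) (hi0 : S.height i z = 0)
    (he : z.1 ∈ closure (S.dom e)) (he0 : S.height e z = 0) :
    ∃ k₁ k₂ k₃, k₁ ≠ k₂ ∧ k₁ ≠ k₃ ∧ k₂ ≠ k₃ ∧
      z ∈ closure (C k₁) ∧ z ∈ closure (C k₂) ∧ z ∈ closure (C k₃) := by
  have hCX : ∀ k, Disjoint (C k) S.carrier := fun k =>
    disjoint_left.2 fun w hw => by
      have : w ∈ ⋃ k, C k := mem_iUnion.2 ⟨k, hw⟩
      rw [hcov] at this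
      exact this
  have hslope : S.slope e - S.slope i ≠ 0 := sub_ne_zero.2 (slope_ne_of_touch hie he hi he0 hi0)
  have hze : z.1 ∉ S.dom e := fun h => hie (eq_of_touch h hi he0 hi0)
  have hrel : ∀ w, S.height e w = 0 →
      S.height i w = (S.slope e - S.slope i) * (w.1 - z.1) := by
    intro w hw
    simp only [height] at hw hi0 he0 ⊢
    linear_combination hw + hi0 - he0
  -- a half plane of line `i` in which piece `e` fills its line near `z`
  obtain ⟨κ, hκ, hev⟩ : ∃ κ : ℝ, κ ≠ 0 ∧
      ∀ᶠ w in 𝓝 z, w ∈ {w | 0 < κ * S.height i w} → S.height e w = 0 → w.1 ∈ S.dom e := by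
    obtain ⟨c, hc⟩ := S.nonempty_dom e
    have hcz : c ≠ z.1 := fun h => hze (h ▸ hc)
    have hfill : ∀ᶠ w in 𝓝 z, 0 < (w.1 - z.1) * (c - z.1) → w.1 ∈ S.dom e := by
      have hev : ∀ᶠ w in 𝓝 z, |w.1 - z.1| < |c - z.1| := by
        have hc' : ContinuousAt (fun w : ℝ × ℝ => |w.1 - z.1|) z := by fun_prop
        refine hc'.eventually_lt continuousAt_const ?_
        simpa [sub_eq_zero] using hcz
      filter_upwards [hev] with w hw hpos
      rcases lt_or_gt_of_ne hcz with h | h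
      · have hwz : w.1 < z.1 := by nlinarith
        rw [abs_of_neg (by linarith), abs_of_neg (by linarith)] at hw
        obtain ⟨x, hx, hxe⟩ := mem_closure_iff.1 he (Ioi w.1) isOpen_Ioi hwz
        exact (S.ordConnected_dom e).out hc hxe ⟨by linarith, (le_of_lt hx)⟩
      · have hwz : z.1 < w.1 := by nlinarith
        rw [abs_of_pos (by linarith), abs_of_pos (by linarith)] at hw
        obtain ⟨x, hx, hxe⟩ := mem_closure_iff.1 he (Iio w.1) isOpen_Iio hwz
        exact (S.ordConnected_dom e).out hxe hc ⟨(le_of_lt hx), by linarith⟩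
    -- By `hrel` this is the value of `height i` at the point of piece `e` over `c`. Thus `0 < κ *
    -- height i` describes the side of line `i` on which piece `e` lies.
    refine ⟨(S.slope e - S.slope i) * (c - z.1), mul_ne_zero hslope (sub_ne_zero.2 hcz), ?_⟩
    filter_upwards [hfill] with w hw hpos hw0
    apply hw
    have hpos' : 0 < (S.slope e - S.slope i) * (c - z.1) * S.height i w := hpos
    rw [hrel w hw0] at hpos'
    have h2 : 0 < (S.slope e - S.slope i) ^ 2 := by positivity
    have : 0 < (S.slope e - S.slope i) ^ 2 * ((w.1 - z.1) * (c - z.1)) := by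
      calc 0 < _ := hpos'
        _ = _ := by ring
    exact pos_of_mul_pos_right this h2.le
  have hcone : ∀ τ : ℝ, τ ≠ 0 →
      z ∈ closure ({w | 0 < κ * S.height i w} ∩ {w | τ * S.height e w < 0}) := by
    intro τ hτ
    -- The direction along which `height i` grows at rate `κ` and `height e` at rate `-τ`.
    refine mem_closure_of_direction ((κ + τ) / (S.slope e - S.slope i),
      κ + S.slope i * ((κ + τ) / (S.slope e - S.slope i))) fun t ht => ?_
    have h1 : 0 < κ ^ 2 := by positivity
    have h2 : 0 < τ ^ 2 := by positivity
    constructor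
    · simp only [mem_ofPred_eq, height_add_smul, hi0]
      nlinarith
    · simp only [mem_ofPred_eq, height_add_smul, he0]
      have : κ + S.slope i * ((κ + τ) / (S.slope e - S.slope i)) -
          S.slope e * ((κ + τ) / (S.slope e - S.slope i)) = -τ := by
        field_simp
        ring
      rw [this]
      nlinarith
  -- One cell comes from the side of line `i` without piece `e`; two come from the other side, which
  -- piece `e` divides near `z`.
  obtain ⟨k₁, hk₁⟩ := exists_cell_of_region hcov (isOpen_neg (S := S) i κ) (mem_closure_neg hκ hi0)
  obtain ⟨k₂, hk₂⟩ := exists_cell_of_region hcov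
    ((isOpen_pos (S := S) i κ).inter (isOpen_neg e 1)) (hcone 1 one_ne_zero)
  obtain ⟨k₃, hk₃⟩ := exists_cell_of_region hcov
    ((isOpen_pos (S := S) i κ).inter (isOpen_neg e (-1))) (hcone (-1) (by norm_num))
  have hevi : ∀ᶠ w in 𝓝 z, w ∈ univ → S.height i w = 0 → w.1 ∈ S.dom i := by
    filter_upwards [continuous_fst.continuousAt.eventually_mem ((S.isOpen_dom i).mem_nhds hi)]
      with w hw _ _
    exact hw
  have side : ∀ k τ, z ∈ closure (C k ∩ {w | κ * S.height i w < 0}) →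
      z ∈ closure (C k ∩ ({w | 0 < κ * S.height i w} ∩ {w | τ * S.height e w < 0})) → False := by
    intro k τ h h'
    refine not_both_sides (hconv k) (hCX k) convex_univ hκ hevi ?_ ?_
    · refine closure_mono ?_ h'
      rintro w ⟨h1, h2, h3⟩
      exact ⟨h1, trivial, h2⟩
    · simpa using h
  refine ⟨k₁, k₂, k₃, ?_, ?_, ?_, closure_mono inter_subset_left hk₁,
    closure_mono inter_subset_left hk₂, closure_mono inter_subset_left hk₃⟩
  · rintro rfl
    exact side k₁ _ hk₁ hk₂
  · rintro rfl
    exact side k₁ _ hk₁ hk₃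
  · rintro rfl
    refine not_both_sides (hconv k₂) (hCX k₂) (convex_halfPlane i κ) one_ne_zero hev ?_ hk₂
    convert hk₃ using 4
    simp

end SegmentSystem

/-! ### From drawings to cell families -/

/-- Twice the signed area of the triangle `a b c`. -/
def orient (a b c : ℝ × ℝ) : ℝ := (b.1 - a.1) * (c.2 - a.2) - (b.2 - a.2) * (c.1 - a.1)

lemma collinear_of_orient_eq_zero {a b c : ℝ × ℝ} (hab : a ≠ b) (h : orient a b c = 0) :
    Collinear ℝ ({a, b, c} : Set (ℝ × ℝ)) := by
  rw [collinear_iff_of_mem (p₀ := a) (by simp)]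
  refine ⟨b - a, ?_⟩
  have hc : ∃ r : ℝ, c = r • (b - a) +ᵥ a := by
    unfold orient at h
    by_cases h1 : b.1 - a.1 = 0
    · have h2 : b.2 - a.2 ≠ 0 := fun h2 => hab (Prod.ext (by linarith) (by linarith))
      have h3 : c.1 - a.1 = 0 := by
        rw [h1] at h
        rcases mul_eq_zero.1 (show (b.2 - a.2) * (c.1 - a.1) = 0 by linarith) with h' | h'
        · exact absurd h' h2
        · exact h'
      refine ⟨(c.2 - a.2) / (b.2 - a.2), Prod.ext ?_ ?_⟩
      · simp [h1]; linarith
      · simp; field_simp; ring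
    · refine ⟨(c.1 - a.1) / (b.1 - a.1), Prod.ext ?_ ?_⟩
      · simp; field_simp; ring
      · simp; field_simp; linarith
  rintro q (rfl | rfl | rfl)
  · exact ⟨0, by simp⟩
  · exact ⟨1, by simp⟩
  · exact hc

lemma orient_eq_zero_of_collinear {a b c : ℝ × ℝ} (h : Collinear ℝ ({a, b, c} : Set (ℝ × ℝ))) :
    orient a b c = 0 := by
  rw [collinear_iff_of_mem (p₀ := a) (by simp)] at h
  obtain ⟨v, hv⟩ := h
  obtain ⟨r, hr⟩ := hv b (by simp)
  obtain ⟨s, hs⟩ := hv c (by simp)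
  rw [hr, hs]
  simp [orient]
  ring

namespace SegmentSystem

/-- The segment system formed by the (open) edges of a noncrossing drawing without vertical
edges. -/
lemma exists_of_drawing {V : Type*} (p : V → ℝ × ℝ) (H : SimpleGraph V)
    (hx : ∀ u v, u ≠ v → (p u).1 ≠ (p v).1)
    (hgp : ∀ u v w, u ≠ v → v ≠ w → u ≠ w → orient (p u) (p v) (p w) ≠ 0)
    (hnc : IsNoncrossing p H) :
    ∃ S : SegmentSystem H.edgeSet,
      (∀ i j, i ≠ j → S.slope i = S.slope j → S.icpt i ≠ S.icpt j) ∧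
      ∀ u v (h : H.Adj u v),
        (∀ z ∈ openSegment ℝ (p u) (p v), z.1 ∈ S.dom ⟨s(u, v), h⟩) ∧
        ∀ z ∈ segment ℝ (p u) (p v), z.1 ∈ closure (S.dom ⟨s(u, v), h⟩) ∧
          S.height ⟨s(u, v), h⟩ z = 0 := by
  have hends : ∀ e : H.edgeSet, ∃ a b, s(a, b) = e.1 ∧ (p a).1 < (p b).1 := by
    rintro ⟨e, he⟩
    induction e using Sym2.ind with | _ a b => ?_
    rcases lt_or_gt_of_ne (hx a b (SimpleGraph.Adj.ne he)) with h | h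
    · exact ⟨a, b, rfl, h⟩
    · exact ⟨b, a, Sym2.eq_swap, h⟩
  choose a b hab hlt using hends
  have hadj : ∀ e, H.Adj (a e) (b e) := fun e => by
    have := e.2
    rwa [← hab e] at this
  let m : H.edgeSet → ℝ := fun e => ((p (b e)).2 - (p (a e)).2) / ((p (b e)).1 - (p (a e)).1)
  let c : H.edgeSet → ℝ := fun e => (p (a e)).2 - m e * (p (a e)).1
  have hmb : ∀ e, (p (b e)).2 = m e * (p (b e)).1 + c e := by
    intro e
    have : (p (b e)).1 - (p (a e)).1 ≠ 0 := by linarith [hlt e]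
    simp only [c, m]
    field_simp
    ring
  have hma : ∀ e, (p (a e)).2 = m e * (p (a e)).1 + c e := fun e => by simp [c]
  have hseg : ∀ e x, x ∈ Ioo (p (a e)).1 (p (b e)).1 →
      (x, m e * x + c e) ∈ segment ℝ (p (a e)) (p (b e)) := by
    intro e x hx
    have hd : (p (b e)).1 - (p (a e)).1 ≠ 0 := by linarith [hlt e]
    have hd' : 0 < (p (b e)).1 - (p (a e)).1 := by linarith [hlt e]
    rw [segment_eq_image']
    refine ⟨(x - (p (a e)).1) / ((p (b e)).1 - (p (a e)).1),
      ⟨div_nonneg (by linarith [hx.1]) hd'.le, (div_le_one hd').2 (by linarith [hx.2])⟩,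
      Prod.ext ?_ ?_⟩
    · simp; field_simp; ring
    · simp only [Prod.snd_add, Prod.smul_snd, Prod.snd_sub, smul_eq_mul, hmb, hma]
      field_simp
      ring
  have hdisj : ∀ e e' x, e ≠ e' → x ∈ Ioo (p (a e)).1 (p (b e)).1 →
      x ∈ Ioo (p (a e')).1 (p (b e')).1 → m e * x + c e ≠ m e' * x + c e' := by
    intro e e' x hne hxe hxe' heq
    have h1 := hseg e x hxe
    have h2 := hseg e' x hxe'
    rw [← heq] at h2
    obtain ⟨w, ⟨hw, -⟩, hpw⟩ := hnc _ _ _ _ (hadj e) (hadj e')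
      (by rw [hab, hab]; exact fun h => hne (Subtype.ext h)) ⟨h1, h2⟩
    rcases hw with rfl | hw
    · rw [hpw] at hxe
      exact lt_irrefl _ hxe.1
    · rw [mem_singleton_iff] at hw
      rw [← hw, hpw] at hxe
      exact lt_irrefl _ hxe.2
  refine ⟨⟨m, c, fun e => Ioo (p (a e)).1 (p (b e)).1, fun _ => isOpen_Ioo,
    fun _ => ordConnected_Ioo, fun e => nonempty_Ioo.2 (hlt e), hdisj⟩, ?_, ?_⟩
  · intro e e' hne hm hc
    simp only at hm hc
    -- Distinct edges on a common line would make an endpoint of one collinear with both ends of the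
    -- other.
    obtain ⟨w, hw', hwa, hwb⟩ : ∃ w, (w = a e' ∨ w = b e') ∧ w ≠ a e ∧ w ≠ b e := by
      by_contra hcon
      push Not at hcon
      apply hne
      apply Subtype.ext
      rw [← hab, ← hab]
      have h1 := hcon (a e') (Or.inl rfl)
      have h2 := hcon (b e') (Or.inr rfl)
      have h3 : a e' ≠ b e' := (hadj e').ne
      by_cases h4 : a e' = a e
      · have h5 : b e' = b e := h2 fun h => h3 (h4.trans h.symm)
        rw [h4, h5]
      · have h5 := h1 h4
        have h6 : b e' = a e := by
          by_contra h
          exact h3 (h5.trans (h2 h).symm)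
        rw [h5, h6, Sym2.eq_swap]
    have hw2 : (p w).2 = m e * (p w).1 + c e := by
      rcases hw' with rfl | rfl
      · rw [hma, hm, hc]
      · rw [hmb, hm, hc]
    refine hgp (a e) (b e) w (hadj e).ne (Ne.symm hwb) (Ne.symm hwa) ?_
    simp only [orient]
    rw [hw2, hma, hmb]
    ring
  · intro u v h
    set e : H.edgeSet := ⟨s(u, v), h⟩ with he
    have hab' : s(a e, b e) = s(u, v) := hab e
    have hsegeq : segment ℝ (p u) (p v) = segment ℝ (p (a e)) (p (b e)) ∧
        openSegment ℝ (p u) (p v) = openSegment ℝ (p (a e)) (p (b e)) := by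
      rcases Sym2.eq_iff.1 hab' with ⟨h1, h2⟩ | ⟨h1, h2⟩
      · rw [h1, h2]; exact ⟨rfl, rfl⟩
      · rw [h1, h2]; exact ⟨segment_symm _ _ _, openSegment_symm _ _ _⟩
    rw [hsegeq.1, hsegeq.2]
    have hl := hlt e
    constructor
    · intro z hz
      rw [openSegment_eq_image'] at hz
      obtain ⟨t, ht, rfl⟩ := hz
      simp only [Prod.fst_add, Prod.smul_fst, Prod.fst_sub, smul_eq_mul, mem_Ioo]
      constructor <;> nlinarith [ht.1, ht.2]
    · intro z hz
      rw [segment_eq_image'] at hz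
      obtain ⟨t, ht, rfl⟩ := hz
      rw [closure_Ioo hl.ne]
      constructor
      · simp only [Prod.fst_add, Prod.smul_fst, Prod.fst_sub, smul_eq_mul, mem_Icc]
        constructor <;> nlinarith [ht.1, ht.2]
      · simp only [height, Prod.fst_add, Prod.smul_fst, Prod.fst_sub, smul_eq_mul,
          Prod.snd_add, Prod.smul_snd, Prod.snd_sub, hma, hmb]
        ring

end SegmentSystem

/-- A family of pairwise disjoint convex sets avoiding all edges of a drawing, such that every
vertex of degree at least `0`, `1`, `2` is in the closure of at least `1`, `2`, `3` of them. -/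
structure IsCellFamily {V K : Type*} (p : V → ℝ × ℝ) (H : SimpleGraph V)
    (C : K → Set (ℝ × ℝ)) : Prop where
  convex : ∀ k, Convex ℝ (C k)
  disjoint : Pairwise fun k l => Disjoint (C k) (C l)
  avoid : ∀ u v, H.Adj u v → ∀ k, Disjoint (openSegment ℝ (p u) (p v)) (C k)
  one_cell : ∀ v, ∃ k, p v ∈ closure (C k)
  two_cells : ∀ v w, H.Adj v w → ∃ k l, k ≠ l ∧ p v ∈ closure (C k) ∧ p v ∈ closure (C l)
  three_cells : ∀ v w w', w ≠ w' → H.Adj v w → H.Adj v w' →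
    ∃ k₁ k₂ k₃, k₁ ≠ k₂ ∧ k₁ ≠ k₃ ∧ k₂ ≠ k₃ ∧
      p v ∈ closure (C k₁) ∧ p v ∈ closure (C k₂) ∧ p v ∈ closure (C k₃)

/-- A noncrossing drawing in general position without vertical edges with `k` edges admits a cell
family of at most `k + 1` cells. -/
theorem exists_isCellFamily_of_not_vertical {V : Type*} [Finite V] (p : V → ℝ × ℝ)
    (H : SimpleGraph V) (hx : ∀ u v, u ≠ v → (p u).1 ≠ (p v).1)
    (hgp : ∀ u v w, u ≠ v → v ≠ w → u ≠ w → orient (p u) (p v) (p w) ≠ 0)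
    (hnc : IsNoncrossing p H) :
    ∃ (K : Type) (_ : Finite K) (C : K → Set (ℝ × ℝ)), Nat.card K ≤ H.edgeSet.ncard + 1 ∧
      IsCellFamily p H C := by
  obtain ⟨S₀, hlines, hS₀⟩ := SegmentSystem.exists_of_drawing p H hx hgp hnc
  obtain ⟨S, hs, hi, hdom, hfull⟩ := S₀.exists_isFull hlines
  have hheight : ∀ e z, S.height e z = S₀.height e z := by
    intro e z
    simp [SegmentSystem.height, hs, hi]
  obtain ⟨K, hK, C, hcard, hconv, hdisj, hcov⟩ := SegmentSystem.exists_convex_cells hfull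
  have hend : ∀ v w (h : H.Adj v w), (p v).1 ∈ closure (S.dom ⟨s(v, w), h⟩) ∧
      S.height ⟨s(v, w), h⟩ (p v) = 0 := by
    intro v w h
    have := (hS₀ v w h).2 (p v) (left_mem_segment ℝ _ _)
    exact ⟨closure_mono (hdom _) this.1, by rw [hheight]; exact this.2⟩
  refine ⟨K, hK, C, hcard, hconv, hdisj, ?_, ?_, ?_, ?_⟩
  · intro u v h k
    rw [disjoint_left]
    intro z hz hzC
    have h1 : z ∈ ⋃ k, C k := mem_iUnion.2 ⟨k, hzC⟩
    rw [hcov] at h1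
    refine h1 ⟨⟨s(u, v), h⟩, hdom _ ((hS₀ u v h).1 z hz), ?_⟩
    rw [hheight]
    exact ((hS₀ u v h).2 z (openSegment_subset_segment ℝ _ _ hz)).2
  · intro v
    obtain ⟨k, hk⟩ := SegmentSystem.exists_cell_of_region hcov isOpen_univ
      (subset_closure (mem_univ (p v)))
    exact ⟨k, closure_mono inter_subset_left hk⟩
  · intro v w h
    have := hend v w h
    exact SegmentSystem.two_cells hconv hcov (hfull _ _ this.1 this.2)
  · intro v w w' hne h h'
    have h1 := hend v w h
    have h2 := hend v w' h'
    obtain ⟨i, hi, hi0⟩ := hfull _ _ h1.1 h1.2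
    -- Piece `i` passes through `p v`. At most one of the two edges at `v` belongs to piece `i`, so
    -- the other one ends on it.
    by_cases hie : (⟨s(v, w), h⟩ : H.edgeSet) = i
    · refine SegmentSystem.three_cells hconv hcov (e := ⟨s(v, w'), h'⟩) ?_ hi hi0 h2.1 h2.2
      rw [← hie]
      intro heq
      apply hne
      have : s(v, w') = s(v, w) := congrArg Subtype.val heq
      exact ((Sym2.congr_right).1 this).symm
    · exact SegmentSystem.three_cells hconv hcov hie hi hi0 h1.1 h1.2

/-- The shear `(x, y) ↦ (x + s y, y)`. -/
noncomputable def shear (s : ℝ) : (ℝ × ℝ) ≃L[ℝ] (ℝ × ℝ) :=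
  LinearEquiv.toContinuousLinearEquiv
    { toFun := fun z => (z.1 + s * z.2, z.2)
      invFun := fun z => (z.1 - s * z.2, z.2)
      map_add' := fun z w => by ext <;> simp; ring
      map_smul' := fun c z => by ext <;> simp; ring
      left_inv := fun z => by ext <;> simp
      right_inv := fun z => by ext <;> simp }

lemma shear_apply (s : ℝ) (z : ℝ × ℝ) : shear s z = (z.1 + s * z.2, z.2) := rfl

lemma orient_shear (s : ℝ) (a b c : ℝ × ℝ) :
    orient (shear s a) (shear s b) (shear s c) = orient a b c := by
  simp only [orient, shear_apply]
  ring

/-- A pair of distinct points becomes vertically aligned for at most one value of `s`, so all but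
finitely many shears work. Shears preserve `orient`, and this removes the restriction to
non-vertical edges. -/
lemma exists_shear_not_vertical {V : Type*} [Finite V] {p : V → ℝ × ℝ} (hp : Function.Injective p) :
    ∃ s, ∀ u v, u ≠ v → (shear s (p u)).1 ≠ (shear s (p v)).1 := by
  have hfin : (⋃ a : V × V, {s : ℝ | a.1 ≠ a.2 ∧
      (shear s (p a.1)).1 = (shear s (p a.2)).1}).Finite := by
    refine finite_iUnion fun a => Set.Subsingleton.finite ?_
    rintro s ⟨hne, hs⟩ t ⟨-, ht⟩
    simp only [shear_apply] at hs ht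
    have h : (s - t) * ((p a.1).2 - (p a.2).2) = 0 := by linarith
    rcases mul_eq_zero.1 h with h | h
    · linarith
    · refine absurd (hp (Prod.ext ?_ (by linarith))) hne
      have h' : (p a.1).2 = (p a.2).2 := by linarith
      rw [h'] at hs
      linarith
  obtain ⟨s, hs⟩ := hfin.exists_notMem
  refine ⟨s, fun u v huv h => hs (mem_iUnion.2 ⟨(u, v), huv, h⟩)⟩

/-- A noncrossing drawing in general position with `k` edges admits a cell family of at most
`k + 1` cells. -/
theorem exists_isCellFamily {V : Type*} [Finite V] (p : V → ℝ × ℝ) (hp : Function.Injective p)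
    (H : SimpleGraph V) (hgp : ∀ u v w, u ≠ v → v ≠ w → u ≠ w → orient (p u) (p v) (p w) ≠ 0)
    (hnc : IsNoncrossing p H) :
    ∃ (K : Type) (_ : Finite K) (C : K → Set (ℝ × ℝ)), Nat.card K ≤ H.edgeSet.ncard + 1 ∧
      IsCellFamily p H C := by
  obtain ⟨s, hs⟩ := exists_shear_not_vertical hp
  set L := shear s
  have himg : ∀ a b, segment ℝ (L a) (L b) = L '' segment ℝ a b := fun a b =>
    (image_segment ℝ (L : (ℝ × ℝ) →ₗ[ℝ] (ℝ × ℝ)).toAffineMap a b).symm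
  have himg' : ∀ a b, openSegment ℝ (L a) (L b) = L '' openSegment ℝ a b := fun a b =>
    (image_openSegment ℝ (L : (ℝ × ℝ) →ₗ[ℝ] (ℝ × ℝ)).toAffineMap a b).symm
  obtain ⟨K, hK, C, hcard, hC⟩ := exists_isCellFamily_of_not_vertical (fun v => L (p v)) H hs
    (fun u v w h1 h2 h3 => by simpa only [L, orient_shear] using hgp u v w h1 h2 h3) (by
      intro u v x y huv hxy hne
      rw [himg, himg, ← image_inter L.injective]
      rintro _ ⟨z, hz, rfl⟩
      obtain ⟨w, hw, rfl⟩ := hnc u v x y huv hxy hne hz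
      exact ⟨w, hw, rfl⟩)
  have hcl : ∀ k z, L z ∈ closure (C k) → z ∈ closure (L ⁻¹' C k) := by
    intro k z hz
    have : z ∈ L.toHomeomorph ⁻¹' closure (C k) := hz
    rwa [L.toHomeomorph.preimage_closure] at this
  refine ⟨K, hK, fun k => L ⁻¹' C k, hcard, ?_, ?_, ?_, ?_, ?_, ?_⟩
  · exact fun k => (hC.convex k).linear_preimage (L : (ℝ × ℝ) →ₗ[ℝ] (ℝ × ℝ))
  · exact fun k l hkl => (hC.disjoint hkl).preimage L
  · intro u v h k
    have := hC.avoid u v h k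
    rw [himg'] at this
    rw [disjoint_left] at this ⊢
    exact fun z hz hz' => this (mem_image_of_mem L hz) hz'
  · intro v
    obtain ⟨k, hk⟩ := hC.one_cell v
    exact ⟨k, hcl k _ hk⟩
  · intro v w h
    obtain ⟨k, l, hkl, hk, hl⟩ := hC.two_cells v w h
    exact ⟨k, l, hkl, hcl k _ hk, hcl l _ hl⟩
  · intro v w w' hne h h'
    obtain ⟨k₁, k₂, k₃, h12, h13, h23, h1, h2, h3⟩ := hC.three_cells v w w' hne h h'
    exact ⟨k₁, k₂, k₃, h12, h13, h23, hcl _ _ h1, hcl _ _ h2, hcl _ _ h3⟩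

/-! ### Crossing segments, sight within a cell, centroids -/

/-- The open segments `a b` and `c d` cross properly. -/
def Crosses (a b c d : ℝ × ℝ) : Prop :=
  orient a b c * orient a b d < 0 ∧ orient c d a * orient c d b < 0

lemma exists_affine_param {a b z : ℝ × ℝ} (hz : z ∈ segment ℝ a b) :
    ∃ t ∈ Icc (0 : ℝ) 1, z.1 = a.1 + t * (b.1 - a.1) ∧ z.2 = a.2 + t * (b.2 - a.2) := by
  rw [segment_eq_image'] at hz
  obtain ⟨t, ht, rfl⟩ := hz
  exact ⟨t, ht, by simp, by simp⟩

/-- The lines meet at the point of `c d` with parameter `orient a b c / (orient a b c - orient a b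
d)`, and opposite signs place this ratio strictly between 0 and 1. The same holds on `a b`. -/
lemma Crosses.exists_mem_openSegment {a b c d : ℝ × ℝ} (h : Crosses a b c d) :
    ∃ z, z ∈ openSegment ℝ a b ∧ z ∈ openSegment ℝ c d := by
  have key : ∀ x y : ℝ, x * y < 0 → x - y ≠ 0 ∧ x / (x - y) ∈ Ioo (0 : ℝ) 1 := by
    intro x y hxy
    have hne : x - y ≠ 0 := by
      intro h0
      have : x = y := by linarith
      subst this
      nlinarith [mul_self_nonneg x]
    refine ⟨hne, ?_⟩
    rcases lt_or_gt_of_ne hne with hlt | hgt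
    · have hx : x < 0 := by nlinarith
      refine ⟨div_pos_of_neg_of_neg hx hlt, ?_⟩
      rw [div_lt_one_of_neg hlt]
      nlinarith
    · have hx : 0 < x := by nlinarith
      refine ⟨div_pos hx hgt, ?_⟩
      rw [div_lt_one hgt]
      nlinarith
  obtain ⟨h1, h1'⟩ := key _ _ h.1
  obtain ⟨h2, h2'⟩ := key _ _ h.2
  refine ⟨c + (orient a b c / (orient a b c - orient a b d)) • (d - c), ?_, ?_⟩
  · rw [openSegment_eq_image']
    refine ⟨_, h2', ?_⟩
    have hD : orient c d a - orient c d b = -(orient a b c - orient a b d) := by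
      simp only [orient]; ring
    simp only
    rw [hD, div_neg]
    ext
    · simp only [Prod.fst_add, Prod.smul_fst, Prod.fst_sub, smul_eq_mul]
      field_simp
      simp only [orient]
      ring
    · simp only [Prod.snd_add, Prod.smul_snd, Prod.snd_sub, smul_eq_mul]
      field_simp
      simp only [orient]
      ring
  · rw [openSegment_eq_image']
    exact ⟨_, h1', rfl⟩

/-- `orient a b` is affine in its last argument and vanishes at `z`, a convex combination of `c` and
`d`. Nonzero values at `c` and `d` must then have opposite signs. -/
lemma crosses_of_mem_segment {a b c d z : ℝ × ℝ} (hz : z ∈ segment ℝ a b)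
    (hz' : z ∈ segment ℝ c d) (h1 : orient a b c ≠ 0) (h2 : orient a b d ≠ 0)
    (h3 : orient c d a ≠ 0) (h4 : orient c d b ≠ 0) : Crosses a b c d := by
  have key : ∀ x y t : ℝ, t ∈ Icc (0 : ℝ) 1 → (1 - t) * x + t * y = 0 → x ≠ 0 → y ≠ 0 →
      x * y < 0 := by
    intro x y t ht h hx hy
    by_contra hcon
    rw [not_lt] at hcon
    have hy2 : 0 < y ^ 2 := by positivity
    have h5 : (1 - t) * (x * y) + t * y ^ 2 = 0 := by linear_combination y * h
    have h6 : 0 ≤ (1 - t) * (x * y) := mul_nonneg (by linarith [ht.2]) hcon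
    have h7 : 0 ≤ t * y ^ 2 := mul_nonneg ht.1 hy2.le
    have h8 : t * y ^ 2 = 0 := by linarith
    rcases mul_eq_zero.1 h8 with h9 | h9
    · subst h9
      simp at h
      exact hx h
    · exact absurd h9 hy2.ne'
  obtain ⟨s, hs, hs1, hs2⟩ := exists_affine_param hz
  obtain ⟨t, ht, ht1, ht2⟩ := exists_affine_param hz'
  constructor
  · refine key _ _ t ht ?_ h1 h2
    have e1 : c.1 + t * (d.1 - c.1) = a.1 + s * (b.1 - a.1) := by rw [← hs1, ← ht1]
    have e2 : c.2 + t * (d.2 - c.2) = a.2 + s * (b.2 - a.2) := by rw [← hs2, ← ht2]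
    simp only [orient]
    linear_combination (b.1 - a.1) * e2 - (b.2 - a.2) * e1
  · refine key _ _ s hs ?_ h3 h4
    have e1 : c.1 + t * (d.1 - c.1) = a.1 + s * (b.1 - a.1) := by rw [← hs1, ← ht1]
    have e2 : c.2 + t * (d.2 - c.2) = a.2 + s * (b.2 - a.2) := by rw [← hs2, ← ht2]
    simp only [orient]
    linear_combination -(d.1 - c.1) * e2 + (d.2 - c.2) * e1

lemma segment_inter_segment_eq_of_orient_ne {a b c z : ℝ × ℝ} (h : orient a b c ≠ 0)
    (hz : z ∈ segment ℝ a b) (hz' : z ∈ segment ℝ a c) : z = a := by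
  obtain ⟨s, hs, hs1, hs2⟩ := exists_affine_param hz
  obtain ⟨t, ht, ht1, ht2⟩ := exists_affine_param hz'
  have e1 : t * (c.1 - a.1) = s * (b.1 - a.1) := by linarith
  have e2 : t * (c.2 - a.2) = s * (b.2 - a.2) := by linarith
  have h0 : t * orient a b c = 0 := by
    simp only [orient]
    linear_combination (b.1 - a.1) * e2 - (b.2 - a.2) * e1
  rcases mul_eq_zero.1 h0 with h' | h'
  · subst h'
    exact Prod.ext (by linarith) (by linarith)
  · exact absurd h' h

/-- In general position, two edges with a common endpoint meet only there. -/
lemma inter_subset_of_common_endpoint {V : Type*} {p : V → ℝ × ℝ}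
    (hgp : ∀ u v w, u ≠ v → v ≠ w → u ≠ w → orient (p u) (p v) (p w) ≠ 0) {u v x y : V}
    (huv : u ≠ v) (hxy : x ≠ y) (hne : s(u, v) ≠ s(x, y))
    (hcom : u = x ∨ u = y ∨ v = x ∨ v = y) :
    segment ℝ (p u) (p v) ∩ segment ℝ (p x) (p y) ⊆ p '' (({u, v} : Set V) ∩ {x, y}) := by
  rintro z ⟨hz, hz'⟩
  have key : ∀ a b c : V, a ≠ b → a ≠ c → b ≠ c → z ∈ segment ℝ (p a) (p b) →
      z ∈ segment ℝ (p a) (p c) → p a = z := fun a b c hab hac hbc h h' =>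
    (segment_inter_segment_eq_of_orient_ne (hgp a b c hab hbc hac) h h').symm
  rcases hcom with rfl | rfl | rfl | rfl
  · exact ⟨u, by simp, key u v y huv hxy (fun h => hne (by rw [h])) hz hz'⟩
  · rw [segment_symm] at hz'
    exact ⟨u, by simp, key u v x huv hxy.symm (fun h => hne (by rw [h, Sym2.eq_swap])) hz hz'⟩
  · rw [segment_symm] at hz
    exact ⟨v, by simp, key v u y huv.symm hxy (fun h => hne (by rw [h, Sym2.eq_swap])) hz hz'⟩
  · rw [segment_symm] at hz hz'
    exact ⟨v, by simp, key v u x huv.symm hxy.symm (fun h => hne (by rw [h])) hz hz'⟩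

lemma continuous_orient {X : Type*} [TopologicalSpace X] {f g h : X → ℝ × ℝ} (hf : Continuous f)
    (hg : Continuous g) (hh : Continuous h) : Continuous fun x => orient (f x) (g x) (h x) := by
  unfold orient; fun_prop

/-- Two vertices in the closure of the same cell see each other. -/
lemma IsCellFamily.inter_subset {V K : Type*} {p : V → ℝ × ℝ} {H : SimpleGraph V}
    {C : K → Set (ℝ × ℝ)} (hC : IsCellFamily p H C)
    (hgp : ∀ u v w, u ≠ v → v ≠ w → u ≠ w → orient (p u) (p v) (p w) ≠ 0) {u v : V} (huv : u ≠ v)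
    {k : K} (hu : p u ∈ closure (C k)) (hv : p v ∈ closure (C k)) {x y : V} (hxy : H.Adj x y)
    (hne : s(u, v) ≠ s(x, y)) :
    segment ℝ (p u) (p v) ∩ segment ℝ (p x) (p y) ⊆ p '' (({u, v} : Set V) ∩ {x, y}) := by
  by_cases hcom : u = x ∨ u = y ∨ v = x ∨ v = y
  · exact inter_subset_of_common_endpoint hgp huv hxy.ne hne hcom
  push Not at hcom
  obtain ⟨hux, huy, hvx, hvy⟩ := hcom
  rintro z ⟨hz, hz'⟩
  exfalso
  have hcr := crosses_of_mem_segment hz hz' (hgp u v x huv hvx hux) (hgp u v y huv hvy huy)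
    (hgp x y u hxy.ne huy.symm hux.symm) (hgp x y v hxy.ne hvy.symm hvx.symm)
  -- Crossing is an open condition: an edge crossing the segment from `u` to `v` also crosses a
  -- segment between two nearby points of the cell itself, which convexity forbids.
  have hmem : (p u, p v) ∈ closure (C k ×ˢ C k) := by
    rw [closure_prod_eq]; exact ⟨hu, hv⟩
  have hopen : IsOpen {w : (ℝ × ℝ) × (ℝ × ℝ) | Crosses w.1 w.2 (p x) (p y)} := by
    refine IsOpen.and ?_ ?_
    · exact isOpen_lt ((continuous_orient (by fun_prop) (by fun_prop) (by fun_prop)).mul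
        (continuous_orient (by fun_prop) (by fun_prop) (by fun_prop))) continuous_const
    · exact isOpen_lt ((continuous_orient (by fun_prop) (by fun_prop) (by fun_prop)).mul
        (continuous_orient (by fun_prop) (by fun_prop) (by fun_prop))) continuous_const
  obtain ⟨⟨a, b⟩, hab, haC, hbC⟩ := mem_closure_iff.1 hmem _ hopen hcr
  obtain ⟨w, hw, hw'⟩ := Crosses.exists_mem_openSegment hab
  exact disjoint_left.1 (hC.avoid x y hxy k) hw'
    ((hC.convex k).segment_subset haC hbC (openSegment_subset_segment ℝ _ _ hw))

lemma IsNoncrossing.sup_edge {V : Type*} {p : V → ℝ × ℝ} {H : SimpleGraph V}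
    (hH : IsNoncrossing p H) {u v : V}
    (hnew : ∀ x y, H.Adj x y → s(u, v) ≠ s(x, y) →
      segment ℝ (p u) (p v) ∩ segment ℝ (p x) (p y) ⊆ p '' (({u, v} : Set V) ∩ {x, y})) :
    IsNoncrossing p (H ⊔ SimpleGraph.edge u v) := by
  have hnew' : ∀ a b, s(a, b) = s(u, v) → ∀ x y, H.Adj x y → s(a, b) ≠ s(x, y) →
      segment ℝ (p a) (p b) ∩ segment ℝ (p x) (p y) ⊆ p '' (({a, b} : Set V) ∩ {x, y}) := by
    intro a b hab x y hxy hne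
    rcases Sym2.eq_iff.1 hab with ⟨rfl, rfl⟩ | ⟨rfl, rfl⟩
    · exact hnew x y hxy hne
    · rw [segment_symm, pair_comm]
      exact hnew x y hxy (by rwa [Sym2.eq_swap])
  have hadj : ∀ a b, (SimpleGraph.edge u v).Adj a b → s(a, b) = s(u, v) := by
    intro a b h
    rw [SimpleGraph.edge_adj] at h
    rw [Sym2.eq_iff]
    exact h.1
  intro a b x y hab hxy hne
  rw [SimpleGraph.sup_adj] at hab hxy
  rcases hab with hab | hab
  · rcases hxy with hxy | hxy
    · exact hH a b x y hab hxy hne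
    · rw [inter_comm, inter_comm {a, b}]
      exact hnew' x y (hadj x y hxy) a b hab hne.symm
  · rcases hxy with hxy | hxy
    · exact hnew' a b (hadj a b hab) x y hxy hne
    · exact absurd ((hadj a b hab).trans (hadj x y hxy).symm) hne

/-- A convex set contains the centroid of every nondegenerate triangle with vertices in its
closure. -/
lemma Convex.centroid_mem_of_closure {C : Set (ℝ × ℝ)} (hC : Convex ℝ C) {a b c : ℝ × ℝ}
    (ha : a ∈ closure C) (hb : b ∈ closure C) (hc : c ∈ closure C) (h : orient a b c ≠ 0) :
    ((a.1 + b.1 + c.1) / 3, (a.2 + b.2 + c.2) / 3) ∈ C := by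
  set g : ℝ × ℝ := ((a.1 + b.1 + c.1) / 3, (a.2 + b.2 + c.2) / 3) with hg
  have hmem : (a, b, c) ∈ closure (C ×ˢ (C ×ˢ C)) := by
    rw [closure_prod_eq, closure_prod_eq]; exact ⟨ha, hb, hc⟩
  let κ := orient a b c
  have hκ : 0 < κ * κ := mul_self_pos.2 h
  -- The centroid `g` stays strictly inside every triangle whose vertices are close to `a`, `b`,
  -- `c`, and such vertices can be found in `C`.
  have hopen : IsOpen {w : (ℝ × ℝ) × (ℝ × ℝ) × (ℝ × ℝ) | (0 < κ * orient w.1 w.2.1 g ∧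
      0 < κ * orient w.2.1 w.2.2 g) ∧ 0 < κ * orient w.2.2 w.1 g} := by
    refine IsOpen.and (IsOpen.and ?_ ?_) ?_ <;>
    exact isOpen_lt continuous_const (continuous_const.mul
      (continuous_orient (by fun_prop) (by fun_prop) (by fun_prop)))
  have e1 : orient a b g = κ / 3 := by simp only [orient, hg, κ]; ring
  have e2 : orient b c g = κ / 3 := by simp only [orient, hg, κ]; ring
  have e3 : orient c a g = κ / 3 := by simp only [orient, hg, κ]; ring
  obtain ⟨⟨a', b', c'⟩, ⟨⟨h1, h2⟩, h3⟩, ha', hb', hc'⟩ := mem_closure_iff.1 hmem _ hopen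
    ⟨⟨by simp only [e1]; linarith, by simp only [e2]; linarith⟩, by simp only [e3]; linarith⟩
  simp only at h1 h2 h3 ha' hb' hc'
  -- `x`, `y`, `t` are the unnormalised barycentric coordinates of `g` in the triangle `a' b' c'`,
  -- all positive.
  set x := κ * orient b' c' g
  set y := κ * orient c' a' g
  set t := κ * orient a' b' g
  have hw : (y / (y + t)) • b' + (t / (y + t)) • c' ∈ C :=
    hC hb' hc' (by positivity) (by positivity) (by field_simp)
  have hres := hC ha' hw (a := x / (x + (y + t))) (b := (y + t) / (x + (y + t))) (by positivity)
    (by positivity) (by field_simp)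
  convert hres using 1
  have hyt : y + t ≠ 0 := by positivity
  have hxyt : x + (y + t) ≠ 0 := by positivity
  have hsum : x + (y + t) = κ * orient a' b' c' := by simp only [x, y, t, orient]; ring
  ext
  · simp only [Prod.fst_add, Prod.smul_fst, smul_eq_mul]
    field_simp
    rw [hsum]
    simp only [x, y, t, orient]
    ring
  · simp only [Prod.snd_add, Prod.smul_snd, smul_eq_mul]
    field_simp
    rw [hsum]
    simp only [x, y, t, orient]
    ring

/-! ### Incidence counting and the three lower bounds -/

/-- A matching covers twice as many vertices as it has edges. -/
lemma ncard_support_of_matching {V : Type*} [Finite V] {M : SimpleGraph V}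
    (hM : ∀ v a b : V, M.Adj v a → M.Adj v b → a = b) :
    M.support.ncard = 2 * M.edgeSet.ncard := by
  classical
  have := Fintype.ofFinite V
  have h := M.sum_degrees_eq_twice_card_edges
  have hs : M.support = (Finset.univ.filter (· ∈ M.support) : Finset V) := by ext; simp
  rw [← SimpleGraph.coe_edgeFinset, Set.ncard_coe_finset, ← h, hs, Set.ncard_coe_finset,
    Finset.card_filter]
  refine Finset.sum_congr rfl fun v _ => ?_
  split_ifs with hv
  · obtain ⟨w, hw⟩ := hv
    symm
    rw [← SimpleGraph.card_neighborFinset_eq_degree, Finset.card_eq_one]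
    refine ⟨w, ?_⟩
    ext x
    simp only [SimpleGraph.mem_neighborFinset, Finset.mem_singleton]
    exact ⟨fun hx => hM v x w hx hw, fun hx => hx ▸ hw⟩
  · symm
    rw [← SimpleGraph.card_neighborFinset_eq_degree, Finset.card_eq_zero]
    ext x
    simp only [SimpleGraph.mem_neighborFinset, Finset.notMem_empty, iff_false]
    exact fun hx => hv ⟨x, hx⟩

namespace GeometricGraph

variable {V : Type*}

lemma orient_ne_zero (G : GeometricGraph V) {u v w : V} (huv : u ≠ v) (hvw : v ≠ w) (huw : u ≠ w) :
    orient (G.pos u) (G.pos v) (G.pos w) ≠ 0 := fun h =>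
  G.general_position u v w huv hvw huw
    (collinear_of_orient_eq_zero (fun h' => huv (G.pos_injective h')) h)

/-- Unmatched vertices that share a cell are adjacent, by maximality of the matching. -/
lemma adj_of_mem_closure_cell {G : GeometricGraph V} {M : SimpleGraph V}
    (hM : G.IsMaximalCompatibleMatching M) {K : Type*} {C : K → Set (ℝ × ℝ)}
    (hC : IsCellFamily G.pos (G.graph ⊔ M) C) {u v : V} (huv : u ≠ v) (hu : u ∉ M.support)
    (hv : v ∉ M.support) {k : K} (hku : G.pos u ∈ closure (C k)) (hkv : G.pos v ∈ closure (C k)) :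
    G.graph.Adj u v := by
  by_contra hadj
  have hgp : ∀ u v w, u ≠ v → v ≠ w → u ≠ w → orient (G.pos u) (G.pos v) (G.pos w) ≠ 0 :=
    fun _ _ _ => G.orient_ne_zero
  have hedge : (SimpleGraph.edge u v).Adj u v := by
    rw [SimpleGraph.edge_adj]; exact ⟨Or.inl ⟨rfl, rfl⟩, huv⟩
  have hcomp : G.IsCompatibleMatching (M ⊔ SimpleGraph.edge u v) := by
    refine ⟨?_, ?_, ?_⟩
    · intro w a b ha hb
      rw [SimpleGraph.sup_adj, SimpleGraph.edge_adj] at ha hb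
      have hu' : ∀ x, ¬ M.Adj u x := fun x h => hu ⟨x, h⟩
      have hv' : ∀ x, ¬ M.Adj v x := fun x h => hv ⟨x, h⟩
      rcases ha with ha | ⟨⟨rfl, rfl⟩ | ⟨rfl, rfl⟩, -⟩ <;>
      rcases hb with hb | ⟨⟨h, rfl⟩ | ⟨h, rfl⟩, -⟩
      · exact hM.1.matching w a b ha hb
      · exact absurd (h ▸ ha) (hu' a)
      · exact absurd (h ▸ ha) (hv' a)
      · exact absurd hb (hu' b)
      · rfl
      · exact absurd h huv
      · exact absurd hb (hv' b)
      · exact absurd h.symm huv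
      · rfl
    · rw [disjoint_sup_right]
      refine ⟨hM.1.disjoint, ?_⟩
      rw [disjoint_iff_inf_le]
      intro a b hab
      rw [SimpleGraph.inf_adj, SimpleGraph.edge_adj] at hab
      rcases hab with ⟨h, ⟨⟨rfl, rfl⟩ | ⟨rfl, rfl⟩, -⟩⟩
      · exact hadj h
      · exact hadj h.symm
    · rw [← sup_assoc]
      exact hM.1.noncrossing.sup_edge fun x y hxy hne => hC.inter_subset hgp huv hku hkv hxy hne
  have hle := hM.2 hcomp le_sup_left
  exact hu ⟨v, hle (Or.inr hedge)⟩

open Classical in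
/-- The combinatorial core of the lower bounds: there are `c ≤ |E(G)| + m + 1` cells, a set of
`n - 2m` unmatched vertices, and an incidence relation between them, such that any two unmatched
vertices on a common cell are adjacent. -/
lemma exists_incidence [Fintype V] (G : GeometricGraph V) {d : ℕ} (hd : G.IsRegular d) (hd2 : d ≤ 2) :
    ∃ (K : Type) (_ : Fintype K) (U : Finset V) (inc : K → Finset V),
      2 * Fintype.card K ≤ Fintype.card V * d + 2 * G.mm + 2 ∧
      U.card + 2 * G.mm = Fintype.card V ∧
      (∀ k, inc k ⊆ U) ∧
      (∀ k, ∀ u ∈ inc k, ∀ v ∈ inc k, u ≠ v → G.graph.Adj u v) ∧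
      (d + 1) * U.card ≤ ∑ k, (inc k).card ∧
      (∀ k l, 3 ≤ (inc k).card → inc k = inc l → k = l) := by
  obtain ⟨M, hM, hMcard⟩ := G.exists_mm_eq
  have hgp : ∀ u v w, u ≠ v → v ≠ w → u ≠ w → orient (G.pos u) (G.pos v) (G.pos w) ≠ 0 :=
    fun _ _ _ => G.orient_ne_zero
  obtain ⟨K, hK, C, hcard, hC⟩ := exists_isCellFamily G.pos G.pos_injective (G.graph ⊔ M) hgp
    hM.1.noncrossing
  have := Fintype.ofFinite K
  let U : Finset V := Finset.univ.filter (· ∉ M.support)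
  have hdeg : 2 * G.graph.edgeSet.ncard = Fintype.card V * d := by
    rw [← SimpleGraph.coe_edgeFinset, Set.ncard_coe_finset,
      ← SimpleGraph.sum_degrees_eq_twice_card_edges, Finset.sum_congr rfl fun v _ => hd v]
    simp
  refine ⟨K, this, U, fun k => U.filter fun v => G.pos v ∈ closure (C k), ?_, ?_,
    fun k => Finset.filter_subset _ _, ?_, ?_, ?_⟩
  · have h1 : (G.graph ⊔ M).edgeSet.ncard ≤ G.graph.edgeSet.ncard + M.edgeSet.ncard := by
      rw [SimpleGraph.edgeSet_sup]
      exact Set.ncard_union_le _ _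
    rw [Nat.card_eq_fintype_card] at hcard
    omega
  · have h1 := ncard_support_of_matching hM.1.matching
    have hs : M.support = (Finset.univ.filter (· ∈ M.support) : Finset V) := by ext; simp
    rw [hMcard, hs, Set.ncard_coe_finset] at h1
    rw [← h1, add_comm]
    exact Finset.card_filter_add_card_filter_not (s := Finset.univ) (· ∈ M.support)
  · intro k u hu v hv huv
    simp only [U, Finset.mem_filter, Finset.mem_univ, true_and] at hu hv
    exact adj_of_mem_closure_cell hM hC huv hu.1 hv.1 hu.2 hv.2
  · have hswap : ∑ k, (U.filter fun v => G.pos v ∈ closure (C k)).card =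
        ∑ v ∈ U, (Finset.univ.filter fun k => G.pos v ∈ closure (C k)).card := by
      simp only [Finset.card_filter]
      exact Finset.sum_comm
    rw [hswap, mul_comm, ← smul_eq_mul]
    refine Finset.card_nsmul_le_sum _ _ _ fun v _ => ?_
    have hdv : (G.graph.neighborFinset v).card = d := by
      rw [SimpleGraph.card_neighborFinset_eq_degree]; exact hd v
    have hmem : ∀ k, G.pos v ∈ closure (C k) →
        k ∈ Finset.univ.filter fun k => G.pos v ∈ closure (C k) := fun k hk => by simpa using hk
    interval_cases d
    · obtain ⟨k, hk⟩ := hC.one_cell v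
      exact Finset.card_pos.2 ⟨k, hmem k hk⟩
    · obtain ⟨w, hw⟩ := Finset.card_eq_one.1 hdv
      have hvw : G.graph.Adj v w := by
        rw [← SimpleGraph.mem_neighborFinset, hw]; simp
      obtain ⟨k, l, hkl, hk, hl⟩ := hC.two_cells v w (Or.inl hvw)
      exact Finset.one_lt_card.2 ⟨k, hmem k hk, l, hmem l hl, hkl⟩
    · obtain ⟨w, w', hne, hw⟩ := Finset.card_eq_two.1 hdv
      have hvw : G.graph.Adj v w := by
        rw [← SimpleGraph.mem_neighborFinset, hw]; simp
      have hvw' : G.graph.Adj v w' := by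
        rw [← SimpleGraph.mem_neighborFinset, hw]; simp
      obtain ⟨k₁, k₂, k₃, h12, h13, h23, h1, h2, h3⟩ :=
        hC.three_cells v w w' hne (Or.inl hvw) (Or.inl hvw')
      exact Finset.two_lt_card.2
        ⟨k₁, hmem _ h1, k₂, hmem _ h2, k₃, hmem _ h3, h12, h13, h23⟩
  · intro k l hk hkl
    by_contra hne
    obtain ⟨x, hx, y, hy, z, hz, hxy, hxz, hyz⟩ := Finset.two_lt_card.1 hk
    have hcl : ∀ j v, v ∈ U.filter (fun v => G.pos v ∈ closure (C j)) → G.pos v ∈ closure (C j) :=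
      fun j v hv => (Finset.mem_filter.1 hv).2
    -- Both cells contain the centroid of the common triangle, although distinct cells are disjoint.
    have h1 := (hC.convex k).centroid_mem_of_closure (hcl _ _ hx) (hcl _ _ hy) (hcl _ _ hz)
      (hgp x y z hxy hyz hxz)
    rw [hkl] at hx hy hz
    have h2 := (hC.convex l).centroid_mem_of_closure (hcl _ _ hx) (hcl _ _ hy) (hcl _ _ hz)
      (hgp x y z hxy hyz hxz)
    exact disjoint_left.1 (hC.disjoint hne) h1 h2

open Classical in
lemma clique_subset [Fintype V] {G : SimpleGraph V} {s : Finset V}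
    (hs : ∀ u ∈ s, ∀ v ∈ s, u ≠ v → G.Adj u v) {u : V} (hu : u ∈ s) :
    s.erase u ⊆ G.neighborFinset u := by
  intro v hv
  rw [Finset.mem_erase] at hv
  rw [SimpleGraph.mem_neighborFinset]
  exact hs u hu v hv.2 hv.1.symm

open Classical in
lemma card_clique_le [Fintype V] {G : SimpleGraph V} {d : ℕ} (hd : G.IsRegularOfDegree d)
    {s : Finset V} (hs : ∀ u ∈ s, ∀ v ∈ s, u ≠ v → G.Adj u v) : s.card ≤ d + 1 := by
  rcases s.eq_empty_or_nonempty with rfl | ⟨u, hu⟩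
  · simp
  have h := Finset.card_le_card (clique_subset hs hu)
  rw [SimpleGraph.card_neighborFinset_eq_degree, hd u, Finset.card_erase_of_mem hu] at h
  omega

/-- Lower bound for point sets. -/
theorem card_le_of_isRegular_zero [Fintype V] (G : GeometricGraph V) (hd : G.IsRegular 0) :
    Fintype.card V ≤ 3 * G.mm + 1 := by
  classical
  obtain ⟨K, _, U, inc, hK, hU, -, hadj, hsum, -⟩ := G.exists_incidence hd (by norm_num)
  have h := Finset.sum_le_card_nsmul Finset.univ (fun k => (inc k).card) 1
    fun k _ => card_clique_le hd (hadj k)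
  simp only [Finset.card_univ, smul_eq_mul] at h
  omega

/-- Lower bound for perfect matchings. -/
theorem card_le_of_isRegular_one [Fintype V] (G : GeometricGraph V) (hd : G.IsRegular 1) :
    Fintype.card V ≤ 6 * G.mm + 2 := by
  classical
  obtain ⟨K, _, U, inc, hK, hU, -, hadj, hsum, -⟩ := G.exists_incidence hd (by norm_num)
  have h := Finset.sum_le_card_nsmul Finset.univ (fun k => (inc k).card) 2
    fun k _ => card_clique_le hd (hadj k)
  simp only [Finset.card_univ, smul_eq_mul] at h
  -- `2 (n - 2m) ≤ 2 |K| ≤ n + 2m + 2`.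
  omega

/-- Lower bound for disjoint polygons. -/
theorem card_le_of_isRegular_two [Fintype V] (G : GeometricGraph V) (hd : G.IsRegular 2) :
    Fintype.card V ≤ 11 * G.mm + 3 := by
  classical
  obtain ⟨K, _, U, inc, hK, hU, hsub, hadj, hsum, hinj⟩ := G.exists_incidence hd le_rfl
  have hle : ∀ k, (inc k).card ≤ 3 := fun k => card_clique_le hd (hadj k)
  let T : Finset K := Finset.univ.filter fun k => (inc k).card = 3
  -- full cells are vertex-disjoint triangles
  have hT : 3 * T.card ≤ U.card := by
    have hdisj : (T : Set K).PairwiseDisjoint inc := by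
      intro k hk l hl hkl
      have hk3 : (inc k).card = 3 := (Finset.mem_filter.1 hk).2
      have hl3 : (inc l).card = 3 := (Finset.mem_filter.1 hl).2
      rw [Function.onFun, Finset.disjoint_left]
      intro u huk hul
      apply hkl
      -- In a 2-regular graph a triangle through `u` consists of `u` and its two neighbours, so full
      -- cells sharing a vertex have the same three vertices.
      have heq : ∀ j, (inc j).card = 3 → u ∈ inc j →
          (inc j).erase u = G.graph.neighborFinset u := by
        intro j hj huj
        refine Finset.eq_of_subset_of_card_le (clique_subset (hadj j) huj) ?_
        rw [SimpleGraph.card_neighborFinset_eq_degree, Finset.card_erase_of_mem huj, hj]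
        exact (hd u).le
      refine hinj k l hk3.ge ?_
      rw [← Finset.insert_erase huk, ← Finset.insert_erase hul, heq k hk3 huk, heq l hl3 hul]
    have h1 : (T.biUnion inc).card ≤ U.card :=
      Finset.card_le_card (Finset.biUnion_subset.2 fun k _ => hsub k)
    have h2 : ∑ k ∈ T, (inc k).card = T.card * 3 :=
      Finset.sum_const_nat fun k hk => (Finset.mem_filter.1 hk).2
    rw [Finset.card_biUnion hdisj, h2] at h1
    omega
  have h : ∑ k, (inc k).card ≤ 2 * Fintype.card K + T.card := by
    calc ∑ k, (inc k).card ≤ ∑ k, (2 + if (inc k).card = 3 then 1 else 0) := by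
          refine Finset.sum_le_sum fun k _ => ?_
          have := hle k
          split_ifs <;> omega
      _ = 2 * Fintype.card K + T.card := by
          rw [Finset.sum_add_distrib, Finset.card_filter]
          simp [mul_comm]
  -- From `3 |U| ≤ 2 |K| + |T|` and `3 |T| ≤ |U|` follows `8 |U| ≤ 6 |K|`. With `|U| = n - 2m` and
  -- `2 |K| ≤ 2n + 2m + 2` this is `2n ≤ 22m + 6`.
  omega

end GeometricGraph

/-! ### Tightness: blocked drawings and their realisation in general position -/

/-- The segments `a b` and `c d` are strictly separated by a line. -/
def StrictlySep (a b c d : ℝ × ℝ) : Prop :=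
  ∃ α β : ℝ, (α * a.1 + β * a.2 < α * c.1 + β * c.2 ∧ α * a.1 + β * a.2 < α * d.1 + β * d.2) ∧
    α * b.1 + β * b.2 < α * c.1 + β * c.2 ∧ α * b.1 + β * b.2 < α * d.1 + β * d.2

lemma StrictlySep.symm {a b c d : ℝ × ℝ} (h : StrictlySep a b c d) : StrictlySep c d a b := by
  obtain ⟨α, β, ⟨h1, h2⟩, h3, h4⟩ := h
  exact ⟨-α, -β, ⟨by linarith, by linarith⟩, by linarith, by linarith⟩

lemma StrictlySep.disjoint {a b c d : ℝ × ℝ} (h : StrictlySep a b c d) :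
    segment ℝ a b ∩ segment ℝ c d = ∅ := by
  obtain ⟨α, β, ⟨h1, h2⟩, h3, h4⟩ := h
  rw [eq_empty_iff_forall_notMem]
  rintro z ⟨hz, hz'⟩
  obtain ⟨s, hs, hs1, hs2⟩ := exists_affine_param hz
  obtain ⟨t, ht, ht1, ht2⟩ := exists_affine_param hz'
  have key : ∀ x y u v s t : ℝ, s ∈ Icc (0 : ℝ) 1 → t ∈ Icc (0 : ℝ) 1 → x < u → x < v → y < u →
      y < v → x + s * (y - x) < u + t * (v - u) := by
    intro x y u v s t hs ht h1 h2 h3 h4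
    have h5 : x + s * (y - x) ≤ max x y := by
      rcases le_total x y with h | h
      · rw [max_eq_right h]; nlinarith [hs.1, hs.2]
      · rw [max_eq_left h]; nlinarith [hs.1, hs.2]
    have h6 : min u v ≤ u + t * (v - u) := by
      rcases le_total u v with h | h
      · rw [min_eq_left h]; nlinarith [ht.1, ht.2]
      · rw [min_eq_right h]; nlinarith [ht.1, ht.2]
    exact (h5.trans_lt (max_lt (lt_min h1 h2) (lt_min h3 h4))).trans_le h6
  have := key _ _ _ _ s t hs ht h1 h2 h3 h4
  have e : α * z.1 + β * z.2 = α * z.1 + β * z.2 := rfl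
  nth_rewrite 1 [hs1, hs2] at e
  rw [ht1, ht2] at e
  linarith

/-- A separating line keeps separating under small moves of the endpoints. This serves both the
perturbation into general position and the shrinking of copies into slots. -/
lemma StrictlySep.eventually {X : Type*} {l : Filter X} {a b c d : X → ℝ × ℝ} {a₀ b₀ c₀ d₀ : ℝ × ℝ}
    (ha : Tendsto a l (𝓝 a₀)) (hb : Tendsto b l (𝓝 b₀)) (hc : Tendsto c l (𝓝 c₀))
    (hd : Tendsto d l (𝓝 d₀)) (h : StrictlySep a₀ b₀ c₀ d₀) :
    ∀ᶠ x in l, StrictlySep (a x) (b x) (c x) (d x) := by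
  obtain ⟨α, β, ⟨h1, h2⟩, h3, h4⟩ := h
  have hlin : ∀ {f : X → ℝ × ℝ} {f₀ : ℝ × ℝ}, Tendsto f l (𝓝 f₀) →
      Tendsto (fun x => α * (f x).1 + β * (f x).2) l (𝓝 (α * f₀.1 + β * f₀.2)) := by
    intro f f₀ hf
    have hc : Continuous fun z : ℝ × ℝ => α * z.1 + β * z.2 := by fun_prop
    exact (hc.tendsto f₀).comp hf
  filter_upwards [(hlin ha).eventually_lt (hlin hc) h1, (hlin ha).eventually_lt (hlin hd) h2,
    (hlin hb).eventually_lt (hlin hc) h3, (hlin hb).eventually_lt (hlin hd) h4] with x k1 k2 k3 k4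
  exact ⟨α, β, ⟨k1, k2⟩, k3, k4⟩

lemma Crosses.eventually {X : Type*} {l : Filter X} {a b c d : X → ℝ × ℝ} {a₀ b₀ c₀ d₀ : ℝ × ℝ}
    (ha : Tendsto a l (𝓝 a₀)) (hb : Tendsto b l (𝓝 b₀)) (hc : Tendsto c l (𝓝 c₀))
    (hd : Tendsto d l (𝓝 d₀)) (h : Crosses a₀ b₀ c₀ d₀) :
    ∀ᶠ x in l, Crosses (a x) (b x) (c x) (d x) := by
  have ho : ∀ {f g k : X → ℝ × ℝ} {f₀ g₀ k₀ : ℝ × ℝ}, Tendsto f l (𝓝 f₀) → Tendsto g l (𝓝 g₀) →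
      Tendsto k l (𝓝 k₀) →
      Tendsto (fun x => orient (f x) (g x) (k x)) l (𝓝 (orient f₀ g₀ k₀)) := by
    intro f g k f₀ g₀ k₀ hf hg hk
    have hcont : Continuous fun w : (ℝ × ℝ) × (ℝ × ℝ) × (ℝ × ℝ) => orient w.1 w.2.1 w.2.2 :=
      continuous_orient (by fun_prop) (by fun_prop) (by fun_prop)
    exact (hcont.tendsto (f₀, g₀, k₀)).comp (hf.prodMk_nhds (hg.prodMk_nhds hk))
  filter_upwards [((ho ha hb hc).mul (ho ha hb hd)).eventually_lt_const h.1,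
    ((ho hc hd ha).mul (ho hc hd hb)).eventually_lt_const h.2] with x k1 k2
  exact ⟨k1, k2⟩

/-- A drawing, not necessarily in general position, of a `d`-regular graph `G` with a matching `M`
of `m` edges, such that vertex-disjoint edges are strictly separated and any two unmatched
non-adjacent vertices are strictly blocked by an edge. -/
structure IsBlockedDrawing {V : Type*} (p : V → ℝ × ℝ) (G M : SimpleGraph V) (d m : ℕ) :
    Prop where
  regular : ∀ v, (G.neighborSet v).ncard = d
  matching : ∀ v a b : V, M.Adj v a → M.Adj v b → a = b
  disjoint : Disjoint G M
  support : M.support.ncard = 2 * m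
  sep : ∀ u v x y, (G ⊔ M).Adj u v → (G ⊔ M).Adj x y → u ≠ x → u ≠ y → v ≠ x → v ≠ y →
    StrictlySep (p u) (p v) (p x) (p y)
  blocked : ∀ u v, u ≠ v → u ∉ M.support → v ∉ M.support → ¬ G.Adj u v →
    ∃ x y, (G ⊔ M).Adj x y ∧ Crosses (p u) (p v) (p x) (p y)

lemma IsBlockedDrawing.transport {V W : Type*} {p : V → ℝ × ℝ} {G M : SimpleGraph V} {d m : ℕ}
    (h : IsBlockedDrawing p G M d m) (e : W ≃ V) :
    IsBlockedDrawing (p ∘ e) (G.comap e) (M.comap e) d m := by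
  have hsupp : ∀ v, v ∈ (M.comap e).support ↔ e v ∈ M.support := by
    intro v
    constructor
    · rintro ⟨w, hw⟩
      exact ⟨e w, hw⟩
    · rintro ⟨w, hw⟩
      exact ⟨e.symm w, by simpa using hw⟩
  have hpre : ∀ s : Set V, (e ⁻¹' s).ncard = s.ncard := fun s =>
    Set.ncard_preimage_of_injective_subset_range e.injective (by simp [e.surjective.range_eq])
  refine ⟨fun v => ?_, fun v a b ha hb => e.injective (h.matching _ _ _ ha hb), ?_, ?_, ?_, ?_⟩
  · rw [← h.regular (e v), ← hpre]
    rfl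
  · rw [disjoint_iff_inf_le]
    intro a b hab
    exact (disjoint_iff_inf_le.1 h.disjoint) (show (G ⊓ M).Adj (e a) (e b) from hab)
  · rw [← h.support, ← hpre]
    congr 1
    ext v
    exact hsupp v
  · intro u v x y huv hxy h1 h2 h3 h4
    exact h.sep _ _ _ _ huv hxy (e.injective.ne h1) (e.injective.ne h2) (e.injective.ne h3)
      (e.injective.ne h4)
  · intro u v huv hu hv hadj
    obtain ⟨x, y, hxy, hc⟩ := h.blocked (e u) (e v) (e.injective.ne huv)
      (fun h => hu ((hsupp u).2 h)) (fun h => hv ((hsupp v).2 h)) hadj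
    exact ⟨e.symm x, e.symm y, by simpa using hxy, by simpa using hc⟩

/-- For small positive `t` the first nonzero coefficient dominates. -/
lemma eventually_quadratic_ne_zero {A B C : ℝ} (h : A ≠ 0 ∨ B ≠ 0 ∨ C ≠ 0) :
    ∀ᶠ t in 𝓝[>] (0 : ℝ), A + B * t + C * t ^ 2 ≠ 0 := by
  have hpos : ∀ᶠ t in 𝓝[>] (0 : ℝ), 0 < t := self_mem_nhdsWithin
  by_cases hA : A = 0
  · subst hA
    by_cases hB : B = 0
    · subst hB
      filter_upwards [hpos] with t ht
      have hC : C ≠ 0 := by simpa using h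
      simpa [hC] using ht.ne'
    · have hc : ContinuousAt (fun t : ℝ => B + C * t) 0 := by fun_prop
      filter_upwards [hpos, (hc.eventually_ne (by simpa using hB)).filter_mono nhdsWithin_le_nhds]
        with t ht ht'
      have : 0 + B * t + C * t ^ 2 = t * (B + C * t) := by ring
      rw [this]
      exact mul_ne_zero ht.ne' ht'
  · have hc : ContinuousAt (fun t : ℝ => A + B * t + C * t ^ 2) 0 := by fun_prop
    exact (hc.eventually_ne (by simpa using hA)).filter_mono nhdsWithin_le_nhds

/-- Perturbing points along a parabola puts them in general position. -/
lemma eventually_general_position {n : ℕ} (p : Fin n → ℝ × ℝ) :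
    ∀ᶠ t in 𝓝[>] (0 : ℝ),
      (∀ u v : Fin n, u ≠ v → p u + t • ((u : ℝ), (u : ℝ) ^ 2) ≠ p v + t • ((v : ℝ), (v : ℝ) ^ 2)) ∧
      ∀ u v w : Fin n, u ≠ v → v ≠ w → u ≠ w →
        orient (p u + t • ((u : ℝ), (u : ℝ) ^ 2)) (p v + t • ((v : ℝ), (v : ℝ) ^ 2))
          (p w + t • ((w : ℝ), (w : ℝ) ^ 2)) ≠ 0 := by
  have hinj : ∀ u v : Fin n, u ≠ v → ((u : ℝ) - (v : ℝ)) ≠ 0 := by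
    intro u v huv h
    have : ((u : ℕ) : ℝ) = ((v : ℕ) : ℝ) := by linarith
    exact huv (Fin.ext (by exact_mod_cast this))
  refine Eventually.and ?_ ?_
  · simp only [eventually_all]
    intro u v huv
    filter_upwards [eventually_quadratic_ne_zero (A := (p u).1 - (p v).1) (B := (u : ℝ) - (v : ℝ))
      (C := 0) (Or.inr (Or.inl (hinj u v huv)))] with t ht heq
    apply ht
    have := congrArg Prod.fst heq
    simp only [Prod.fst_add, Prod.smul_fst, smul_eq_mul] at this
    linear_combination this
  · simp only [eventually_all]
    intro u v w huv hvw huw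
    -- The coefficient of `t ^ 2` is the orientation of three points on the parabola, a Vandermonde
    -- determinant. It is nonzero whatever `p` is.
    have hC : orient ((u : ℝ), (u : ℝ) ^ 2) ((v : ℝ), (v : ℝ) ^ 2) ((w : ℝ), (w : ℝ) ^ 2) ≠ 0 := by
      have : orient ((u : ℝ), (u : ℝ) ^ 2) ((v : ℝ), (v : ℝ) ^ 2) ((w : ℝ), (w : ℝ) ^ 2) =
          ((v : ℝ) - u) * ((w : ℝ) - u) * ((w : ℝ) - v) := by
        simp only [orient]; ring
      rw [this]
      exact mul_ne_zero (mul_ne_zero (hinj v u huv.symm) (hinj w u huw.symm)) (hinj w v hvw.symm)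
    filter_upwards [eventually_quadratic_ne_zero (A := orient (p u) (p v) (p w))
      (B := ((p v).1 - (p u).1) * ((w : ℝ) ^ 2 - (u : ℝ) ^ 2) +
        ((v : ℝ) - u) * ((p w).2 - (p u).2) - ((p v).2 - (p u).2) * ((w : ℝ) - u) -
        ((v : ℝ) ^ 2 - (u : ℝ) ^ 2) * ((p w).1 - (p u).1))
      (Or.inr (Or.inr hC))] with t ht heq
    apply ht
    rw [← heq]
    simp only [orient, Prod.fst_add, Prod.smul_fst, Prod.snd_add, Prod.smul_snd, smul_eq_mul]
    ring

/-- Every blocked drawing can be realised in general position; its matching is then maximal. -/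
theorem IsBlockedDrawing.exists_geometricGraph {n : ℕ} {p : Fin n → ℝ × ℝ}
    {G M : SimpleGraph (Fin n)} {d m : ℕ} (h : IsBlockedDrawing p G M d m) :
    ∃ Γ : GeometricGraph (Fin n), Γ.IsRegular d ∧ Γ.mm ≤ m := by
  let q : ℝ → Fin n → ℝ × ℝ := fun t u => p u + t • ((u : ℝ), (u : ℝ) ^ 2)
  have hq : ∀ u, Tendsto (fun t => q t u) (𝓝[>] 0) (𝓝 (p u)) := by
    intro u
    have hc : Continuous fun t => q t u := by fun_prop
    have := hc.tendsto 0
    simp only [q, zero_smul, add_zero] at this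
    exact this.mono_left nhdsWithin_le_nhds
  have hsep : ∀ᶠ t in 𝓝[>] (0 : ℝ), ∀ u v x y, (G ⊔ M).Adj u v → (G ⊔ M).Adj x y → u ≠ x →
      u ≠ y → v ≠ x → v ≠ y → StrictlySep (q t u) (q t v) (q t x) (q t y) := by
    simp only [eventually_all]
    intro u v x y h1 h2 h3 h4 h5 h6
    exact StrictlySep.eventually (hq u) (hq v) (hq x) (hq y) (h.sep u v x y h1 h2 h3 h4 h5 h6)
  have hblk : ∀ᶠ t in 𝓝[>] (0 : ℝ), ∀ u v, u ≠ v → u ∉ M.support → v ∉ M.support → ¬ G.Adj u v →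
      ∃ x y, (G ⊔ M).Adj x y ∧ Crosses (q t u) (q t v) (q t x) (q t y) := by
    simp only [eventually_all]
    intro u v h1 h2 h3 h4
    obtain ⟨x, y, hxy, hc⟩ := h.blocked u v h1 h2 h3 h4
    filter_upwards [Crosses.eventually (hq u) (hq v) (hq x) (hq y) hc] with t ht
    exact ⟨x, y, hxy, ht⟩
  obtain ⟨t, ⟨⟨hinj, hgp⟩, hsep⟩, hblk⟩ :=
    (((eventually_general_position p).and hsep).and hblk).exists
  have hnc : IsNoncrossing (q t) (G ⊔ M) := by
    intro u v x y huv hxy hne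
    by_cases hcom : u = x ∨ u = y ∨ v = x ∨ v = y
    · exact inter_subset_of_common_endpoint hgp huv.ne hxy.ne hne hcom
    · push Not at hcom
      rw [(hsep u v x y huv hxy hcom.1 hcom.2.1 hcom.2.2.1 hcom.2.2.2).disjoint]
      exact empty_subset _
  let Γ : GeometricGraph (Fin n) :=
    { pos := q t
      graph := G
      pos_injective := fun u v huv => by
        by_contra hne
        exact hinj u v hne huv
      general_position := fun u v w huv hvw huw hcol =>
        hgp u v w huv hvw huw (orient_eq_zero_of_collinear hcol)
      noncrossing := fun u v x y huv hxy hne => hnc u v x y (Or.inl huv) (Or.inl hxy) hne }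
  refine ⟨Γ, ?_, ?_⟩
  · intro v
    classical
    rw [← h.regular v, ← Nat.card_coe_set_eq, Nat.card_eq_fintype_card,
      SimpleGraph.card_neighborSet_eq_degree]
  · have hmax : Γ.IsMaximalCompatibleMatching M := by
      -- An edge that a larger compatible matching adds joins two vertices unmatched in `M` and
      -- non-adjacent in `G`. Some edge of `G ⊔ M` therefore crosses it, away from common endpoints.
      refine ⟨⟨h.matching, h.disjoint, hnc⟩, fun M' hM' hle u v huv => ?_⟩
      by_contra hMuv
      have hu : u ∉ M.support := by
        rintro ⟨x, hx⟩
        exact hMuv (hM'.matching u x v (hle hx) huv ▸ hx)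
      have hv : v ∉ M.support := by
        rintro ⟨x, hx⟩
        exact hMuv ((hM'.matching v x u (hle hx) huv.symm ▸ hx).symm)
      have hG : ¬ G.Adj u v := fun hG =>
        (disjoint_iff_inf_le.1 hM'.disjoint) (show (G ⊓ M').Adj u v from ⟨hG, huv⟩)
      obtain ⟨x, y, hxy, hc⟩ := hblk u v huv.ne hu hv hG
      have hoa : ∀ a b : ℝ × ℝ, orient a b a = 0 := fun a b => by simp [orient]
      have hob : ∀ a b : ℝ × ℝ, orient a b b = 0 := fun a b => by simp only [orient]; ring
      have hx : x ≠ u ∧ x ≠ v := by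
        constructor <;> rintro rfl <;> simpa [hoa, hob] using hc.1
      have hy : y ≠ u ∧ y ≠ v := by
        constructor <;> rintro rfl <;> simpa [hoa, hob] using hc.1
      obtain ⟨z, hz, hz'⟩ := hc.exists_mem_openSegment
      obtain ⟨w, ⟨hw, hw'⟩, -⟩ := hM'.noncrossing u v x y (Or.inr huv)
        (sup_le_sup_left hle G hxy) (by
          intro heq
          rcases Sym2.eq_iff.1 heq with ⟨h1, -⟩ | ⟨h1, -⟩
          · exact hx.1 h1.symm
          · exact hy.1 h1.symm)
        ⟨openSegment_subset_segment ℝ _ _ hz, openSegment_subset_segment ℝ _ _ hz'⟩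
      rcases hw with rfl | rfl <;> rcases hw' with h' | h'
      · exact hx.1 h'.symm
      · exact hy.1 h'.symm
      · exact hx.2 h'.symm
      · exact hy.2 h'.symm
    refine Nat.sInf_le ⟨M, hmax, ?_⟩
    have := ncard_support_of_matching h.matching
    have := h.support
    omega

/-! ### Skeletons and substitution into their slots -/

/-- The disjoint union of `G₀` with one copy of `G` for every element of `S`. -/
def addCopies {W V : Type*} (S : Type*) (G₀ : SimpleGraph W) (G : SimpleGraph V) :
    SimpleGraph (W ⊕ S × V) where
  Adj a b := match a, b with
    | Sum.inl u, Sum.inl v => G₀.Adj u v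
    | Sum.inr x, Sum.inr y => x.1 = y.1 ∧ G.Adj x.2 y.2
    | _, _ => False
  symm := ⟨by
    rintro (u | x) (v | y) h
    · exact SimpleGraph.Adj.symm (G := G₀) h
    · exact h
    · exact h
    · exact ⟨h.1.symm, h.2.symm⟩⟩
  loopless := ⟨by
    rintro (u | x) h
    · exact G₀.loopless.irrefl u h
    · exact G.loopless.irrefl x.2 h.2⟩

section AddCopies

variable {W V S : Type*} {G₀ M₀ : SimpleGraph W} {G M : SimpleGraph V}

lemma addCopies_sup : addCopies S G₀ G ⊔ addCopies S M₀ M = addCopies S (G₀ ⊔ M₀) (G ⊔ M) := by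
  ext (u | x) (v | y)
  · rfl
  · exact or_self_iff
  · exact or_self_iff
  · exact and_or_left.symm

lemma inl_mem_support_addCopies {w : W} :
    (Sum.inl w : W ⊕ S × V) ∈ (addCopies S M₀ M).support ↔ w ∈ M₀.support := by
  constructor
  · rintro ⟨v | y, h⟩
    · exact ⟨v, h⟩
    · exact h.elim
  · rintro ⟨v, h⟩
    exact ⟨Sum.inl v, h⟩

lemma inr_mem_support_addCopies {s : S} {v : V} :
    (Sum.inr (s, v) : W ⊕ S × V) ∈ (addCopies S M₀ M).support ↔ v ∈ M.support := by
  constructor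
  · rintro ⟨w | y, h⟩
    · exact h.elim
    · exact ⟨y.2, h.2⟩
  · rintro ⟨y, h⟩
    exact ⟨Sum.inr (s, y), rfl, h⟩

lemma ncard_neighborSet_addCopies {d : ℕ} (h₀ : ∀ w, (G₀.neighborSet w).ncard = d)
    (h : ∀ v, (G.neighborSet v).ncard = d) (a : W ⊕ S × V) :
    ((addCopies S G₀ G).neighborSet a).ncard = d := by
  rcases a with w | ⟨s, v⟩
  · rw [← h₀ w, ← Set.ncard_image_of_injective (G₀.neighborSet w)
      (Sum.inl_injective (β := S × V))]
    congr 1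
    ext (u | y)
    · simp only [SimpleGraph.mem_neighborSet, mem_image, Sum.inl.injEq, exists_eq_right]
      rfl
    · simp only [SimpleGraph.mem_neighborSet, mem_image, reduceCtorEq, and_false, exists_false,
        iff_false]
      exact id
  · have hinj : Function.Injective fun v : V => (Sum.inr (s, v) : W ⊕ S × V) := by
      intro a b hab
      simpa using hab
    rw [← h v, ← Set.ncard_image_of_injective (G.neighborSet v) hinj]
    congr 1
    ext (u | ⟨t, y⟩)
    · simp only [SimpleGraph.mem_neighborSet, mem_image, reduceCtorEq, and_false, exists_false,
        iff_false]
      exact id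
    · simp only [SimpleGraph.mem_neighborSet, mem_image, Sum.inr.injEq, Prod.mk.injEq]
      constructor
      · rintro ⟨rfl, h⟩
        exact ⟨y, h, rfl, rfl⟩
      · rintro ⟨y', h, rfl, rfl⟩
        exact ⟨rfl, h⟩

end AddCopies

/-- A drawing of a `d`-regular graph with a perfect matching, together with a family of points
(slots) off the edges that are pairwise strictly blocked by the edges. -/
structure IsSkeleton {W S : Type*} (r : W → ℝ × ℝ) (q : S → ℝ × ℝ) (G M : SimpleGraph W) (d : ℕ) :
    Prop where
  regular : ∀ v, (G.neighborSet v).ncard = d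
  matching : ∀ v a b : W, M.Adj v a → M.Adj v b → a = b
  perfect : ∀ v, v ∈ M.support
  disjoint : Disjoint G M
  sep : ∀ u v x y, (G ⊔ M).Adj u v → (G ⊔ M).Adj x y → u ≠ x → u ≠ y → v ≠ x → v ≠ y →
    StrictlySep (r u) (r v) (r x) (r y)
  slot_sep : ∀ s x y, (G ⊔ M).Adj x y → StrictlySep (q s) (q s) (r x) (r y)
  blocked : ∀ s t, s ≠ t → ∃ x y, (G ⊔ M).Adj x y ∧ Crosses (q s) (q t) (r x) (r y)

/-- Filling every slot of a skeleton with a small copy of a blocked drawing gives a blocked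
drawing. -/
theorem IsSkeleton.substitute {W S V : Type*} [Finite W] [Finite S] [Finite V] {r : W → ℝ × ℝ}
    {q : S → ℝ × ℝ} {G₀ M₀ : SimpleGraph W} {d : ℕ} (hS : IsSkeleton r q G₀ M₀ d) {m₀ : ℕ}
    (hm₀ : Nat.card W = 2 * m₀) {p : V → ℝ × ℝ} {G M : SimpleGraph V} {m : ℕ}
    (h : IsBlockedDrawing p G M d m) :
    ∃ P : W ⊕ S × V → ℝ × ℝ, IsBlockedDrawing P (addCopies S G₀ G) (addCopies S M₀ M) d
      (m₀ + Nat.card S * m) := by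
  have hq : ∀ s v, Tendsto (fun t : ℝ => q s + t • p v) (𝓝[>] 0) (𝓝 (q s)) := by
    intro s v
    have hc : Continuous fun t : ℝ => q s + t • p v := by fun_prop
    have := hc.tendsto 0
    simp only [zero_smul, add_zero] at this
    exact this.mono_left nhdsWithin_le_nhds
  have h1 : ∀ᶠ t in 𝓝[>] (0 : ℝ), ∀ s u v x y, (G₀ ⊔ M₀).Adj x y →
      StrictlySep (q s + t • p u) (q s + t • p v) (r x) (r y) := by
    simp only [eventually_all]
    intro s u v x y hxy
    exact (hS.slot_sep s x y hxy).eventually (hq s u) (hq s v) tendsto_const_nhds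
      tendsto_const_nhds
  have h2 : ∀ᶠ t in 𝓝[>] (0 : ℝ), ∀ s s' u v x y, s ≠ s' →
      StrictlySep (q s + t • p u) (q s + t • p v) (q s' + t • p x) (q s' + t • p y) := by
    simp only [eventually_all]
    intro s s' u v x y hne
    have hqne : q s ≠ q s' := by
      intro heq
      obtain ⟨x, y, -, hc⟩ := hS.blocked s s' hne
      have := hc.1
      simp [orient, heq] at this
    have hsep : StrictlySep (q s) (q s) (q s') (q s') := by
      have hpos : 0 < ((q s').1 - (q s).1) ^ 2 + ((q s').2 - (q s).2) ^ 2 := by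
        rcases eq_or_ne (q s).1 (q s').1 with h | h
        · have h' : (q s').2 - (q s).2 ≠ 0 := fun h' => hqne (Prod.ext h (by linarith))
          positivity
        · have h' : (q s').1 - (q s).1 ≠ 0 := sub_ne_zero.2 h.symm
          positivity
      have hlt : ((q s').1 - (q s).1) * (q s).1 + ((q s').2 - (q s).2) * (q s).2 <
          ((q s').1 - (q s).1) * (q s').1 + ((q s').2 - (q s).2) * (q s').2 := by linarith
      exact ⟨(q s').1 - (q s).1, (q s').2 - (q s).2, ⟨hlt, hlt⟩, hlt, hlt⟩
    exact hsep.eventually (hq s u) (hq s v) (hq s' x) (hq s' y)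
  have h3 : ∀ᶠ t in 𝓝[>] (0 : ℝ), ∀ s s' u v, s ≠ s' →
      ∃ x y, (G₀ ⊔ M₀).Adj x y ∧ Crosses (q s + t • p u) (q s' + t • p v) (r x) (r y) := by
    simp only [eventually_all]
    intro s s' u v hne
    obtain ⟨x, y, hxy, hc⟩ := hS.blocked s s' hne
    filter_upwards [hc.eventually (hq s u) (hq s' v) tendsto_const_nhds tendsto_const_nhds]
      with t ht
    exact ⟨x, y, hxy, ht⟩
  obtain ⟨t, ⟨⟨h1, h2⟩, h3⟩, ht⟩ := (((h1.and h2).and h3).and self_mem_nhdsWithin).exists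
  have ht : 0 < t := ht
  refine ⟨Sum.elim r fun x => q x.1 + t • p x.2, ncard_neighborSet_addCopies hS.regular h.regular,
    ?_, ?_, ?_, ?_, ?_⟩
  · rintro (w | x) (a | a) (b | b) ha hb
    · exact congrArg Sum.inl (hS.matching w a b ha hb)
    · exact hb.elim
    · exact ha.elim
    · exact ha.elim
    · exact ha.elim
    · exact ha.elim
    · exact hb.elim
    · exact congrArg Sum.inr (Prod.ext (ha.1.symm.trans hb.1) (h.matching _ _ _ ha.2 hb.2))
  · rw [disjoint_iff_inf_le]
    rintro (a | a) (b | b) ⟨h1, h2⟩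
    · exact disjoint_iff_inf_le.1 hS.disjoint ⟨h1, h2⟩
    · exact h1
    · exact h1
    · exact disjoint_iff_inf_le.1 h.disjoint ⟨h1.2, h2.2⟩
  · have hsupp : (addCopies S M₀ M).support =
        Sum.inl '' univ ∪ Sum.inr '' (univ ×ˢ M.support) := by
      ext (w | ⟨s, v⟩)
      · simp [inl_mem_support_addCopies, hS.perfect w]
      · simp [inr_mem_support_addCopies]
    rw [hsupp, Set.ncard_union_eq (by
        rw [disjoint_left]
        rintro _ ⟨a, -, rfl⟩ ⟨b, -, h⟩
        cases h) (toFinite _) (toFinite _),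
      Set.ncard_image_of_injective _ Sum.inl_injective,
      Set.ncard_image_of_injective _ Sum.inr_injective, Set.ncard_prod, h.support,
      Set.ncard_univ, Set.ncard_univ, hm₀]
    ring
  · rw [addCopies_sup]
    rintro (u | u) (v | v) (x | x) (y | y) huv hxy hux huy hvx hvy
    · exact hS.sep u v x y huv hxy (by simpa using hux) (by simpa using huy) (by simpa using hvx)
        (by simpa using hvy)
    · exact hxy.elim
    · exact hxy.elim
    · obtain ⟨s, x⟩ := x
      obtain ⟨s', y⟩ := y
      obtain rfl : s = s' := hxy.1
      exact (h1 s x y u v huv).symm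
    · exact huv.elim
    · exact huv.elim
    · exact huv.elim
    · exact huv.elim
    · exact huv.elim
    · exact huv.elim
    · exact huv.elim
    · exact huv.elim
    · obtain ⟨s, u⟩ := u
      obtain ⟨s', v⟩ := v
      obtain rfl : s = s' := huv.1
      exact h1 s u v x y hxy
    · exact hxy.elim
    · exact hxy.elim
    · obtain ⟨s, u⟩ := u
      obtain ⟨s', v⟩ := v
      obtain ⟨s₂, x⟩ := x
      obtain ⟨s₂', y⟩ := y
      obtain rfl : s = s' := huv.1
      obtain rfl : s₂ = s₂' := hxy.1
      by_cases hs : s = s₂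
      · subst hs
        obtain ⟨α, β, ⟨k1, k2⟩, k3, k4⟩ := h.sep u v x y huv.2 hxy.2 (by simpa using hux)
          (by simpa using huy) (by simpa using hvx) (by simpa using hvy)
        refine ⟨α, β, ⟨?_, ?_⟩, ?_, ?_⟩ <;>
        · simp only [Sum.elim_inr, Prod.fst_add, Prod.snd_add, Prod.smul_fst, Prod.smul_snd,
            smul_eq_mul]
          nlinarith
      · exact h2 s s₂ u v x y hs
  · rw [addCopies_sup]
    rintro (u | ⟨s, u⟩) (v | ⟨s', v⟩) huv hu hv hG
    · exact absurd (inl_mem_support_addCopies.2 (hS.perfect u)) hu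
    · exact absurd (inl_mem_support_addCopies.2 (hS.perfect u)) hu
    · exact absurd (inl_mem_support_addCopies.2 (hS.perfect v)) hv
    · by_cases hs : s = s'
      · subst hs
        obtain ⟨x, y, hxy, hc⟩ := h.blocked u v (fun h => huv (by rw [h]))
          (fun h => hu (inr_mem_support_addCopies.2 h))
          (fun h => hv (inr_mem_support_addCopies.2 h)) (fun h => hG ⟨rfl, h⟩)
        refine ⟨Sum.inr (s, x), Sum.inr (s, y), ⟨rfl, hxy⟩, ?_⟩
        -- Scaling by `t` multiplies orientations by `t ^ 2`, so crossings within a copy persist.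
        have hor : ∀ a b c, orient (q s + t • a) (q s + t • b) (q s + t • c) =
            t ^ 2 * orient a b c := by
          intro a b c
          simp only [orient, Prod.fst_add, Prod.snd_add, Prod.smul_fst, Prod.smul_snd,
            smul_eq_mul]
          ring
        have ht4 : 0 < t ^ 4 := by positivity
        simp only [Crosses, Sum.elim_inr, hor]
        constructor
        · nlinarith [hc.1]
        · nlinarith [hc.2]
      · obtain ⟨x, y, hxy, hc⟩ := h3 s s' u v hs
        exact ⟨Sum.inl x, Sum.inl y, hxy, hc⟩

/-- A complete graph on at most three vertices, all drawn at the same point. -/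
lemma isBlockedDrawing_top {d : ℕ} (hd : d ≤ 2) :
    IsBlockedDrawing (fun _ : Fin (d + 1) => (0 : ℝ × ℝ)) ⊤ ⊥ d 0 := by
  refine ⟨fun v => ?_, fun _ _ _ h => h.elim, disjoint_bot_right, ?_, ?_, ?_⟩
  · have : (⊤ : SimpleGraph (Fin (d + 1))).neighborSet v = {v}ᶜ := by
      ext w
      simp [eq_comm]
    rw [this, Set.ncard_compl, Set.ncard_singleton]
    simp
  · have : (⊥ : SimpleGraph (Fin (d + 1))).support = ∅ := by
      ext v
      simp
    simp [this]
  -- Two disjoint edges need four vertices, and here there are at most three; this is why all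
  -- vertices may share one point.
  · intro u v x y huv hxy h1 h2 h3 h4
    have := huv.ne
    have := hxy.ne
    omega
  · intro u v huv _ _ h
    exact absurd huv h

/-! ### Integer certificates and the three skeletons -/

/-- Orientation for integer points. -/
def orientInt (a b c : ℤ × ℤ) : ℤ := (b.1 - a.1) * (c.2 - a.2) - (b.2 - a.2) * (c.1 - a.1)

/-- An integer point as a point of the real plane. -/
def toPlane (a : ℤ × ℤ) : ℝ × ℝ := (a.1, a.2)

lemma orient_toPlane (a b c : ℤ × ℤ) :
    orient (toPlane a) (toPlane b) (toPlane c) = orientInt a b c := by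
  simp [orient, orientInt, toPlane]

/-- A linear form vanishing on `b - a` takes one value at `a` and `b`; since `c` and `d` lie
strictly on the same side of line `a b`, with the right sign it is larger at both. -/
lemma strictlySep_of_orient {a b c d : ℝ × ℝ} (h : 0 < orient a b c * orient a b d) :
    StrictlySep a b c d := by
  rcases pos_and_pos_or_neg_and_neg_of_mul_pos h with ⟨h1, h2⟩ | ⟨h1, h2⟩
  · simp only [orient] at h1 h2
    exact ⟨-(b.2 - a.2), b.1 - a.1, ⟨by linarith, by linarith⟩, by linarith, by linarith⟩
  · simp only [orient] at h1 h2
    exact ⟨b.2 - a.2, -(b.1 - a.1), ⟨by linarith, by linarith⟩, by linarith, by linarith⟩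

lemma strictlySep_point {a b c : ℝ × ℝ} (h : orient a b c ≠ 0) : StrictlySep c c a b :=
  (strictlySep_of_orient (mul_self_pos.2 h)).symm

/-- The graph with the given list of edges. -/
def graphOfList {k : ℕ} (L : List (Fin k × Fin k)) : SimpleGraph (Fin k) where
  Adj a b := a ≠ b ∧ ((a, b) ∈ L ∨ (b, a) ∈ L)
  symm := ⟨fun _ _ h => ⟨h.1.symm, h.2.symm⟩⟩
  loopless := ⟨fun _ h => h.1 rfl⟩

instance {k : ℕ} (L : List (Fin k × Fin k)) : DecidableRel (graphOfList L).Adj := fun a b =>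
  inferInstanceAs (Decidable (a ≠ b ∧ ((a, b) ∈ L ∨ (b, a) ∈ L)))

/-- Integral criterion for a skeleton. -/
lemma isSkeleton_of_int {k l d : ℕ} {r : Fin k → ℤ × ℤ} {q : Fin l → ℤ × ℤ}
    {G M : SimpleGraph (Fin k)} [DecidableRel G.Adj] [DecidableRel M.Adj]
    (hreg : ∀ v, (Finset.univ.filter fun w => G.Adj v w).card = d)
    (hM : ∀ v a b, M.Adj v a → M.Adj v b → a = b) (hperf : ∀ v, ∃ w, M.Adj v w)
    (hdisj : ∀ a b, G.Adj a b → ¬ M.Adj a b)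
    (hsep : ∀ u v, (G.Adj u v ∨ M.Adj u v) → ∀ x y, (G.Adj x y ∨ M.Adj x y) →
      u ≠ x → u ≠ y → v ≠ x → v ≠ y →
      0 < orientInt (r u) (r v) (r x) * orientInt (r u) (r v) (r y) ∨
        0 < orientInt (r x) (r y) (r u) * orientInt (r x) (r y) (r v))
    (hslot : ∀ x y, (G.Adj x y ∨ M.Adj x y) → ∀ s, orientInt (r x) (r y) (q s) ≠ 0)
    (hblk : ∀ s t, s ≠ t → ∃ x y, (G.Adj x y ∨ M.Adj x y) ∧
      orientInt (q s) (q t) (r x) * orientInt (q s) (q t) (r y) < 0 ∧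
      orientInt (r x) (r y) (q s) * orientInt (r x) (r y) (q t) < 0) :
    IsSkeleton (toPlane ∘ r) (toPlane ∘ q) G M d := by
  refine ⟨fun v => ?_, hM, hperf, ?_, ?_, ?_, ?_⟩
  · rw [← hreg v, ← Set.ncard_coe_finset]
    congr 1
    ext w
    simp
  · rw [disjoint_iff_inf_le]
    exact fun a b h => hdisj a b h.1 h.2
  · intro u v x y huv hxy h1 h2 h3 h4
    rcases hsep u v huv x y hxy h1 h2 h3 h4 with h | h
    · refine strictlySep_of_orient ?_
      simp only [Function.comp, orient_toPlane]
      exact_mod_cast h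
    · refine (strictlySep_of_orient ?_).symm
      simp only [Function.comp, orient_toPlane]
      exact_mod_cast h
  · intro s x y hxy
    refine strictlySep_point ?_
    simp only [Function.comp, orient_toPlane]
    exact_mod_cast hslot x y hxy s
  · intro s t hst
    obtain ⟨x, y, hxy, h1, h2⟩ := hblk s t hst
    refine ⟨x, y, hxy, ?_, ?_⟩ <;> simp only [Function.comp, orient_toPlane] <;>
    assumption_mod_cast

/-- A skeleton whose numbers of vertices and slots are balanced yields arbitrarily large blocked
drawings with `c * m + d + 1` vertices and `m` matching edges. -/
theorem IsSkeleton.exists_isBlockedDrawing {k l d m₀ c : ℕ} {r : Fin k → ℝ × ℝ}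
    {q : Fin l → ℝ × ℝ} {G₀ M₀ : SimpleGraph (Fin k)} (hS : IsSkeleton r q G₀ M₀ d) (hd : d ≤ 2)
    (hk : k = 2 * m₀) (hm₀ : 0 < m₀) (hl : 0 < l)
    (hbal : 2 * m₀ + l * (d + 1) = c * m₀ + (d + 1)) (j : ℕ) :
    ∃ m, j ≤ m ∧ ∃ (p : Fin (c * m + (d + 1)) → ℝ × ℝ) (G M : SimpleGraph (Fin (c * m + (d + 1)))),
      IsBlockedDrawing p G M d m := by
  induction j with
  | zero =>
    refine ⟨0, le_rfl, ?_⟩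
    have e : Fin (c * 0 + (d + 1)) ≃ Fin (d + 1) := finCongr (by simp)
    exact ⟨_, _, _, (isBlockedDrawing_top hd).transport e⟩
  | succ j ih =>
    obtain ⟨m, hjm, p, G, M, h⟩ := ih
    obtain ⟨P, hP⟩ := hS.substitute (m₀ := m₀) (by simpa using hk) h
    rw [Nat.card_eq_fintype_card, Fintype.card_fin] at hP
    refine ⟨m₀ + l * m, ?_, ?_⟩
    · have := Nat.le_mul_of_pos_left m hl
      omega
    -- Substitution leads from `m` to `m₀ + l * m` matching edges, and `hbal` is what keeps the
    -- number of vertices equal to `c` times that plus `d + 1`.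
    · have hcard : Fintype.card (Fin k ⊕ Fin l × Fin (c * m + (d + 1))) =
          c * (m₀ + l * m) + (d + 1) := by
        simp only [Fintype.card_sum, Fintype.card_prod, Fintype.card_fin]
        rw [hk]
        linear_combination hbal
      exact ⟨_, _, _, hP.transport (Fintype.equivFinOfCardEq hcard).symm⟩

/-- A single segment with a slot on either side. -/
lemma isSkeleton_segment :
    IsSkeleton (toPlane ∘ ![(0, -1), (0, 1)]) (toPlane ∘ ![(-1, 0), (1, 0)])
      (graphOfList []) (graphOfList [(0, 1)]) 0 :=
  isSkeleton_of_int (by decide +kernel) (by decide +kernel) (by decide +kernel)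
    (by decide +kernel) (by decide +kernel) (by decide +kernel) (by decide +kernel)

/-- A square whose sides alternate between graph and matching, with a slot in the centre and one
outside close to each side. -/
lemma isSkeleton_square :
    IsSkeleton (toPlane ∘ ![(0, 0), (10, 0), (10, 10), (0, 10)])
      (toPlane ∘ ![(5, 5), (5, -1), (11, 5), (5, 11), (-1, 5)])
      (graphOfList [(0, 1), (2, 3)]) (graphOfList [(1, 2), (3, 0)]) 1 :=
  isSkeleton_of_int (by decide +kernel) (by decide +kernel) (by decide +kernel)
    (by decide +kernel) (by decide +kernel) (by decide +kernel) (by decide +kernel)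

/-- Two nested triangles joined by three twisted matching edges, such that every vertex has a reflex
angle, with ten slots. -/
lemma isSkeleton_prism :
    IsSkeleton (toPlane ∘ ![(-14, 12), (-3, -18), (17, 6), (0, 4), (-3, -2), (3, -2)])
      (toPlane ∘ ![(0, 0), (-9, -3), (8, -7), (2, 10), (-7, 9), (2, 1), (-4, -10), (-2, 1),
        (11, 1), (0, -3)])
      (graphOfList [(0, 1), (1, 2), (2, 0), (3, 4), (4, 5), (5, 3)])
      (graphOfList [(0, 3), (1, 4), (2, 5)]) 2 :=
  isSkeleton_of_int (by decide +kernel) (by decide +kernel) (by decide +kernel)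
    (by decide +kernel) (by decide +kernel) (by decide +kernel) (by decide +kernel)

/-! ### Conclusion -/

/-- A balanced skeleton together with the matching lower bound gives tightness for infinitely many
numbers of vertices. -/
theorem IsSkeleton.infinite_tight {k l d m₀ c : ℕ} {r : Fin k → ℝ × ℝ}
    {q : Fin l → ℝ × ℝ} {G₀ M₀ : SimpleGraph (Fin k)} (hS : IsSkeleton r q G₀ M₀ d) (hd : d ≤ 2)
    (hk : k = 2 * m₀) (hm₀ : 0 < m₀) (hl : 0 < l) (hc : 0 < c)
    (hbal : 2 * m₀ + l * (d + 1) = c * m₀ + (d + 1))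
    (hlow : ∀ n (G : GeometricGraph (Fin n)), G.IsRegular d → n ≤ c * G.mm + (d + 1)) :
    {n : ℕ | ∃ G : GeometricGraph (Fin n),
      G.IsRegular d ∧ (G.mm : ℝ) = ((n : ℝ) - (d + 1 : ℕ)) / c}.Infinite := by
  refine Set.infinite_of_forall_exists_gt fun a => ?_
  obtain ⟨m, ham, p, G, M, h⟩ := hS.exists_isBlockedDrawing hd hk hm₀ hl hbal a
  obtain ⟨Γ, hreg, hmm⟩ := h.exists_geometricGraph
  refine ⟨c * m + (d + 1), ⟨Γ, hreg, ?_⟩, ?_⟩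
  · have h1 := hlow _ Γ hreg
    -- For `n = c * m + (d + 1)` the lower bound reads `c * m ≤ c * Γ.mm`, so the constructed
    -- matching is a smallest maximal one.
    have h2 : m ≤ Γ.mm := Nat.le_of_mul_le_mul_left (by omega) hc
    have h3 : Γ.mm = m := le_antisymm hmm h2
    rw [h3]
    have : (c : ℝ) ≠ 0 := by positivity
    push_cast
    field_simp
    ring
  · have := Nat.le_mul_of_pos_left m hc
    omega

theorem theorem2 :
    (∀ (V : Type*) [Fintype V] (G : GeometricGraph V),
      (G.IsRegular 0 → ((Fintype.card V : ℝ) - 1) / 3 ≤ (G.mm : ℝ)) ∧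
      (G.IsRegular 1 → ((Fintype.card V : ℝ) - 2) / 6 ≤ (G.mm : ℝ)) ∧
      (G.IsRegular 2 → ((Fintype.card V : ℝ) - 3) / 11 ≤ (G.mm : ℝ))) ∧
    {n : ℕ | ∃ G : GeometricGraph (Fin n),
      G.IsRegular 0 ∧ (G.mm : ℝ) = ((n : ℝ) - 1) / 3}.Infinite ∧
    {n : ℕ | ∃ G : GeometricGraph (Fin n),
      G.IsRegular 1 ∧ (G.mm : ℝ) = ((n : ℝ) - 2) / 6}.Infinite ∧
    {n : ℕ | ∃ G : GeometricGraph (Fin n),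
      G.IsRegular 2 ∧ (G.mm : ℝ) = ((n : ℝ) - 3) / 11}.Infinite := by
  refine ⟨fun V _ G => ⟨fun h => ?_, fun h => ?_, fun h => ?_⟩, ?_, ?_, ?_⟩
  · have : (Fintype.card V : ℝ) ≤ 3 * G.mm + 1 := by exact_mod_cast G.card_le_of_isRegular_zero h
    linarith
  · have : (Fintype.card V : ℝ) ≤ 6 * G.mm + 2 := by exact_mod_cast G.card_le_of_isRegular_one h
    linarith
  · have : (Fintype.card V : ℝ) ≤ 11 * G.mm + 3 := by exact_mod_cast G.card_le_of_isRegular_two h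
    linarith
  · simpa using isSkeleton_segment.infinite_tight (m₀ := 1) (c := 3) (by norm_num) rfl (by norm_num)
      (by norm_num) (by norm_num) (by norm_num)
      fun n G hG => by simpa using G.card_le_of_isRegular_zero hG
  · have := isSkeleton_square.infinite_tight (m₀ := 2) (c := 6) (by norm_num) rfl (by norm_num)
      (by norm_num) (by norm_num) (by norm_num)
      fun n G hG => by simpa using G.card_le_of_isRegular_one hG
    norm_num at this
    exact this
  · have := isSkeleton_prism.infinite_tight (m₀ := 3) (c := 11) (by norm_num) rfl (by norm_num)
      (by norm_num) (by norm_num) (by norm_num)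
      fun n G hG => by simpa using G.card_le_of_isRegular_two hG
    norm_num at this
    exact this
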